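/- **Setting.** Let $\Theta\subseteq\mathbb R^d$ carry a metric $\rho$, and let $\mathcal P_2(\Theta)$ and $W_2$ be the Wasserstein space and distance of order 2 for $\rho$ (the inclusion $\Theta\to\mathbb R^d$ being Borel for $\rho$). Let $\theta_0\in\Theta$, and let $\Pi$ be a prior probability on $\Theta$ with a Lebesgue density. For each $m$ there are $n=k m$ independent observations $Y_{ji}$ ($1\le j\le k$, $1\le i\le m$), where $k=k_m$. Under $\theta$, $Y_{ji}$ has density $p_{ji}(\cdot\mid\theta)$ with respect to a $\sigma$-finite measure $\nu_{ji}$, jointly measurable in $(\theta,y)$; spaces, measures and densities may depend on $m$. Let $\gamma=\gamma_m>0$. The $j$th subset posterior is $$\Pi_m(d\theta\mid Y_{[j]})=\frac{\{\prod_{i=1}^m p_{ji}(Y_{ji}\mid\theta)\}^{\gamma}\,\Pi(d\theta)}{\int_\Theta\{\prod_{i=1}^m p_{ji}(Y_{ji}\mid\theta')\}^{\gamma}\,\Pi(d\theta')},$$ with the convention that it is $\Pi$ where the denominator is $0$ or $\infty$. The WASP $\overline\Pi_n(\cdot\mid Y^{(n)})$ is any minimizer over $\mu\in\mathcal P_2(\Theta)$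 of $\sum_{j=1}^k\frac1k W_2^2\{\mu,\Pi_m(\cdot\mid Y_{[j]})\}$. Put $$h_{mj}^2(\theta,\theta')=\frac1m\sum_{i=1}^m\int\left(\sqrt{p_{ji}(\cdot\mid\theta)}-\sqrt{p_{ji}(\cdot\mid\theta')}\right)^2d\nu_{ji}.$$ For $\Xi\subseteq\Theta$ and $u>0$ let $N_{[]}(u,\Xi,h_{mj})$ be the least $N$ for which there are measurable functions $0\le l_{si}\le u_{si}$ ($1\le s\le N$, $1\le i\le m$) with $\frac1m\sum_i\int(\sqrt{u_{si}}-\sqrt{l_{si}})^2d\nu_{ji}\le u^2$ for all $s$, such that for every $\theta\in\Xi$ some $s$ satisfies $l_{si}\le p_{ji}(\cdot\mid\theta)\le u_{si}$ pointwise for all $i$; let $H_{[]}=\log(1+N_{[]})$. **Assumptions.** The constants and $\Psi$ below do not depend on $m$ or $j$, and the conditions are required for all sufficiently large $m$ and all $j=1,\dots,k$. * (A1) $\Theta$ is compact in $\rho$; $\theta_0$ is an interior point of $\Theta$ in $\mathbb R^d$; $g_1\gamma m\le n\le g_2\gamma m$ for some constants $g_1,g_2>0$. * (A2) With constants $\alpha,C_L>0$,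 $h_{mj}^2(\theta,\theta')\ge C_L\,\rho^{2\alpha}(\theta,\theta')$ for all $\theta,\theta'\in\Theta$. * (A3) There are constants $0<D_1\le1$, $0<D_2<D_1^2/2^{12}$, $K>0$ and a function $\Psi(u,r)\ge0$, nonincreasing in $u>0$ and nondecreasing in $r>0$, such that for all $r>0$ with $r\ge K\log m/\sqrt m$: $H_{[]}(u,\{\theta:h_{mj}(\theta,\theta_0)\le r\},h_{mj})\le\Psi(u,r)$ for all $u>0$, and $\int_{D_1r^2/2^{12}}^{D_1r}\sqrt{\Psi(u,r)}\,du<D_2\sqrt m\,r^2$. * (A4) There are constants $\kappa,c_\pi>0$ such that $$\Pi\left(\theta:\frac1m\sum_{i=1}^mE_{P_{\theta_0}}\exp\left(\kappa\log_+\frac{p_{ji}(Y_{ji}\mid\theta_0)}{p_{ji}(Y_{ji}\mid\theta)}\right)-1\le\frac{\log^2m}{m}\right)\ge\exp(-c_\pi k\log^2m),$$ where $\log_+x=\max(\log x,0)$ and $\log_+\infty=\infty$. * (A5) $\Theta$ is convex, and $\rho(\sum_{i=1}^Nw_i\theta_i,\theta')\le\sum_{i=1}^Nw_i\rho(\theta_i,\theta')$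 for all $N$, all $\theta_1,\dots,\theta_N,\theta'\in\Theta$ and all weights $w_i\ge0$ with $\sum_iw_i=1$. **Theorem.** Under (A1)–(A5), as $m\to\infty$, $$W_2\left\{\overline\Pi_n(\cdot\mid Y^{(n)}),\delta_{\theta_0}\right\}=O_p\left(\sqrt{\frac{\log^{2/\alpha}m}{m^{1/\alpha}}}\right)$$ in $P_{\theta_0}^{(n)}$-probability (outer probability, if the WASP is not chosen measurably). -/

import Mathlib

open MeasureTheory Filter
open scoped ENNReal

noncomputable section

universe u v

/-! ### Wasserstein space of order 2 and barycenters -/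

/-- Couplings of `μ` and `ν`: measures on the product with marginals `μ` and `ν`. -/
def couplings {Θ : Type u} [MeasurableSpace Θ] (μ ν : Measure Θ) : Set (Measure (Θ × Θ)) :=
  {π | π.map Prod.fst = μ ∧ π.map Prod.snd = ν}

/-- The Wasserstein distance of order 2 for the metric of `Θ`. -/
def W2 {Θ : Type u} [MetricSpace Θ] [MeasurableSpace Θ] (μ ν : Measure Θ) : ℝ≥0∞ :=
  (⨅ π ∈ couplings μ ν, ∫⁻ z, edist z.1 z.2 ^ 2 ∂π) ^ (1 / 2 : ℝ)

/-- The Wasserstein space of order 2: probability measures with finite second moment. -/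
def P2 (Θ : Type u) [MetricSpace Θ] [MeasurableSpace Θ] : Set (Measure Θ) :=
  {μ | IsProbabilityMeasure μ ∧ ∀ a : Θ, ∫⁻ x, edist a x ^ 2 ∂μ < ∞}

/-- `μ` minimizes `∑ j, (1 / k) * W2 μ (Π_j) ^ 2` over the Wasserstein space. -/
def IsBarycenter {Θ : Type u} [MetricSpace Θ] [MeasurableSpace Θ] {k : ℕ}
    (Pi : Fin k → Measure Θ) (μ : Measure Θ) : Prop :=
  μ ∈ P2 Θ ∧ ∀ ν ∈ P2 Θ,
    ∑ j, (k : ℝ≥0∞)⁻¹ * W2 μ (Pi j) ^ 2 ≤ ∑ j, (k : ℝ≥0∞)⁻¹ * W2 ν (Pi j) ^ 2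

/-! ### The model of one data subset -/

/-- The model of one subset `(Y_1, …, Y_m)` of independent, not necessarily identically
distributed observations: `Y_i` takes values in `obs i` and has, under the parameter `θ`, the
density `p i θ` with respect to the σ-finite measure `ν i`. -/
structure SubsetModel (Θ : Type u) [MeasurableSpace Θ] (m : ℕ) where
  obs : Fin m → Type v
  [meas : ∀ i, MeasurableSpace (obs i)]
  ν : ∀ i, Measure (obs i)
  [sigmaFinite : ∀ i, SigmaFinite (ν i)]
  p : ∀ i, Θ → obs i → ℝ
  p_nonneg : ∀ i θ y, 0 ≤ p i θ y
  p_measurable : ∀ i, Measurable (fun z : Θ × obs i => p i z.1 z.2)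
  p_lintegral : ∀ i θ, ∫⁻ y, ENNReal.ofReal (p i θ y) ∂(ν i) = 1

attribute [instance] SubsetModel.meas SubsetModel.sigmaFinite

namespace SubsetModel

variable {Θ : Type u} [MeasurableSpace Θ] {m : ℕ} (M : SubsetModel.{u, v} Θ m)

/-- The space of values of the whole subset `(Y_1, …, Y_m)`. -/
abbrev Data : Type v := ∀ i, M.obs i

/-- The distribution of the `i`th observation under `θ`. -/
def obsLaw (θ : Θ) (i : Fin m) : Measure (M.obs i) :=
  (M.ν i).withDensity fun y => ENNReal.ofReal (M.p i θ y)

/-- The distribution of the whole subset under `θ`. -/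
def law (θ : Θ) : Measure M.Data :=
  Measure.pi (M.obsLaw θ)

/-- The likelihood of the subset. -/
def likelihood (y : M.Data) (θ : Θ) : ℝ :=
  ∏ i, M.p i θ (y i)

/-- The normalizing constant of the subset posterior. -/
def evidence (prior : Measure Θ) (γ : ℝ) (y : M.Data) : ℝ≥0∞ :=
  ∫⁻ θ, ENNReal.ofReal (M.likelihood y θ ^ γ) ∂prior

open Classical in
/-- The subset posterior, whose density with respect to the prior is proportional to the likelihood
raised to the power `γ`. For data where the normalizing constant is `0` or `∞` the posterior is not
defined by this formula, and it is set equal to the prior there. -/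
def posterior (prior : Measure Θ) (γ : ℝ) (y : M.Data) : Measure Θ :=
  if M.evidence prior γ y ≠ 0 ∧ M.evidence prior γ y ≠ ∞ then
    (M.evidence prior γ y)⁻¹ •
      prior.withDensity fun θ => ENNReal.ofReal (M.likelihood y θ ^ γ)
  else prior

/-- The pseudo Hellinger distance of the subset. -/
def hell (θ₁ θ₂ : Θ) : ℝ :=
  Real.sqrt ((1 / m : ℝ) *
    ∑ i, ∫ y, (Real.sqrt (M.p i θ₁ y) - Real.sqrt (M.p i θ₂ y)) ^ 2 ∂(M.ν i))

/-- The pairs `[l s, u s]`, `s < N`, form a generalized `δ`-bracketing set of the densities with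
parameter in `Ξ`: the norm of `√(u s) - √(l s)` is the Hellinger one,
`((1 / m) * ∑ i, ∫ (√(u s i) - √(l s i)) ^ 2 ∂(ν i)) ^ (1 / 2)`, and has to be at most `δ`. -/
def IsBracketing (Ξ : Set Θ) (δ : ℝ) {N : ℕ} (l u : Fin N → ∀ i, M.obs i → ℝ) : Prop :=
  (∀ s i, Measurable (l s i) ∧ Measurable (u s i) ∧ ∀ y, 0 ≤ l s i y ∧ l s i y ≤ u s i y) ∧
  (∀ s, (m : ℝ≥0∞)⁻¹ *
    ∑ i, ∫⁻ y, ENNReal.ofReal ((Real.sqrt (u s i y) - Real.sqrt (l s i y)) ^ 2) ∂(M.ν i)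
      ≤ ENNReal.ofReal (δ ^ 2)) ∧
  ∀ θ ∈ Ξ, ∃ s, ∀ i y, l s i y ≤ M.p i θ y ∧ M.p i θ y ≤ u s i y

/-- The bracketing number: the smallest cardinality of a generalized `δ`-bracketing set
(`∞` if there is no finite one). -/
def bracketingNumber (Ξ : Set Θ) (δ : ℝ) : ℝ≥0∞ :=
  ⨅ (N : ℕ) (_ : ∃ l u : Fin N → ∀ i, M.obs i → ℝ, M.IsBracketing Ξ δ l u), (N : ℝ≥0∞)

/-- The bracketing entropy `log (1 + N)`. -/
def bracketingEntropy (Ξ : Set Θ) (δ : ℝ) : EReal :=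
  ENNReal.log (1 + M.bracketingNumber Ξ δ)

/-- `(1 / m) * ∑ i, E_{θ₀} exp (κ * log₊ (p i θ₀ (Y_i) / p i θ (Y_i)))`, where
`exp (κ * log₊ x) = (max 1 x) ^ κ`; the ratio is `∞` where only the denominator vanishes. -/
def expLogRatio (κ : ℝ) (θ₀ θ : Θ) : ℝ≥0∞ :=
  (m : ℝ≥0∞)⁻¹ * ∑ i, ∫⁻ y,
    (max 1 (ENNReal.ofReal (M.p i θ₀ y) / ENNReal.ofReal (M.p i θ y))) ^ κ ∂(M.obsLaw θ₀ i)

end SubsetModel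

/-! ### The assumptions, for a triangular array with `k m` subsets of size `m` -/

/-- With `n = k m * m` observations in `k m` subsets of size `m`, the powers `γ m > 0` satisfy
`g₁ * γ m * m ≤ n ≤ g₂ * γ m * m` for some constants `g₁, g₂ > 0`. -/
def PowerCondition (k : ℕ → ℕ) (γ : ℕ → ℝ) : Prop :=
  (∀ m, 0 < γ m) ∧ ∃ g₁ > (0 : ℝ), ∃ g₂ > (0 : ℝ), ∀ᶠ m : ℕ in atTop,
    g₁ * γ m * m ≤ (k m : ℝ) * m ∧ (k m : ℝ) * m ≤ g₂ * γ m * m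

/-- The pseudo Hellinger distances dominate the power `α` of the metric. -/
def HellingerLowerBound {Θ : Type u} [MetricSpace Θ] [MeasurableSpace Θ] {k : ℕ → ℕ}
    (M : ∀ m, Fin (k m) → SubsetModel.{u, v} Θ m) (α : ℝ) : Prop :=
  ∃ C > (0 : ℝ), ∀ᶠ m : ℕ in atTop, ∀ j, ∀ θ θ' : Θ,
    C * dist θ θ' ^ (2 * α) ≤ (M m j).hell θ θ' ^ 2

/-- The entropy condition. The bounds hold for all large `m`, uniformly over the radii
`r ≥ K * log m / √m`. -/
def EntropyCondition {Θ : Type u} [MeasurableSpace Θ] {k : ℕ → ℕ}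
    (M : ∀ m, Fin (k m) → SubsetModel.{u, v} Θ m) (θ₀ : Θ) : Prop :=
  ∃ D₁ D₂ K : ℝ, ∃ Ψ : ℝ → ℝ → ℝ,
    0 < D₁ ∧ D₁ ≤ 1 ∧ 0 < D₂ ∧ D₂ < D₁ ^ 2 / 2 ^ 12 ∧ 0 < K ∧
    (∀ u > 0, ∀ r > 0, 0 ≤ Ψ u r) ∧
    (∀ r > 0, AntitoneOn (fun u => Ψ u r) (Set.Ioi 0)) ∧
    (∀ u > 0, MonotoneOn (fun r => Ψ u r) (Set.Ioi 0)) ∧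
    ∀ᶠ m : ℕ in atTop, ∀ r : ℝ, 0 < r → K * Real.log m / Real.sqrt m ≤ r →
      (∀ j, ∀ u > 0,
        (M m j).bracketingEntropy {θ | (M m j).hell θ θ₀ ≤ r} u ≤ ((Ψ u r : ℝ) : EReal)) ∧
      ∫ u in (D₁ * r ^ 2 / 2 ^ 12)..(D₁ * r), Real.sqrt (Ψ u r) < D₂ * Real.sqrt m * r ^ 2

/-- Prior thickness around `θ₀`. -/
def PriorThickness {Θ : Type u} [MeasurableSpace Θ] {k : ℕ → ℕ}
    (M : ∀ m, Fin (k m) → SubsetModel.{u, v} Θ m) (prior : Measure Θ) (θ₀ : Θ) : Prop :=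
  ∃ κ > (0 : ℝ), ∃ c > (0 : ℝ), ∀ᶠ m : ℕ in atTop, ∀ j,
    ENNReal.ofReal (Real.exp (-c * k m * Real.log m ^ 2)) ≤
      prior {θ | (M m j).expLogRatio κ θ₀ θ ≤ 1 + ENNReal.ofReal (Real.log m ^ 2 / m)}

/-- The parameter set, seen in `ℝ^d` through its coordinates, contains all convex combinations of
its points, and the metric is convex. -/
def ConvexMetric {Θ : Type u} [MetricSpace Θ] {d : ℕ} (coord : Θ → EuclideanSpace ℝ (Fin d)) :
    Prop :=
  ∀ (N : ℕ) (w : Fin N → ℝ) (x : Fin N → Θ), (∀ i, 0 ≤ w i) → ∑ i, w i = 1 →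
    ∃ z : Θ, coord z = ∑ i, w i • coord (x i) ∧ ∀ θ' : Θ, dist z θ' ≤ ∑ i, w i * dist (x i) θ'

/-! ### Full data and stochastic order -/

/-- The full data: `k` subsets. -/
abbrev FullData {Θ : Type u} [MeasurableSpace Θ] {k m : ℕ}
    (M : Fin k → SubsetModel.{u, v} Θ m) : Type v :=
  ∀ j, (M j).Data

/-- The distribution of the full data under `θ`: all observations are independent. -/
def fullLaw {Θ : Type u} [MeasurableSpace Θ] {k m : ℕ}
    (M : Fin k → SubsetModel.{u, v} Θ m) (θ : Θ) : Measure (FullData M) :=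
  Measure.pi fun j => (M j).law θ

/-- `X m = O_p (a m)` under the probability measures `P m`, as `m → ∞`. -/
def IsBigOInProbability {Ω : ℕ → Type v} [∀ m, MeasurableSpace (Ω m)]
    (P : ∀ m, Measure (Ω m)) (X : ∀ m, Ω m → ℝ≥0∞) (a : ℕ → ℝ) : Prop :=
  ∀ ε > (0 : ℝ), ∃ C > (0 : ℝ), ∀ᶠ m in atTop,
    P m {ω | ENNReal.ofReal (C * a m) < X m ω} ≤ ENNReal.ofReal ε

end

/-! A barycenter does at least as well as the Dirac mass at `θ₀`, so its squared `W2` distance to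
that mass is at most four times the average over the subsets of the posterior second moments about
`θ₀` (`IsBarycenter.W2_sq_dirac_le`). The expectation of an average needs no union over subsets:
Markov's inequality finishes the proof once the expected second moment in each subset is uniformly
`O((log² m / m)^(1/α))` (`fullLaw_W2_barycenter_le`).

In one subset let `r = A log m / √m` with `A` large. In the Hellinger ball of radius `r`, (A2)
bounds `ρ²` by a multiple of the rate. Outside it, off a small event, the likelihood ratio is at
most `exp(-m r² / 32)` uniformly (`exists_exceptional_set`). The evidence is at least `exp(-c k log²
m)` times the powered likelihood of `θ₀`, up to a factor `exp(-O(γ log² m))` and constants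
(`exists_evidence_exceptional_set`). The likelihood ratio is also raised to the power `γ`, and `k =
O(γ)` by (A1), so a large `A` makes it win; what remains is of order `exp(-log² m)`.

The uniform bound (`exists_shell_exceptional_set`) chains on Hellinger shells along running minima
of upper brackets at dyadic scales. The logarithm is replaced by the majorant `logMaj`. Its scaled
exponential is affine, so first moments control the coarsest level. It is Lipschitz, so Hellinger
distances control the second moments of the refinements. Since the minima decrease, every refinement
is a nonnegative loss and only its lower tail matters; that tail is sub-Gaussian from second moments
alone, without boundedness. The entropy integral pays for the union bounds, and the drift `-h² / 2`
from the Hellinger affinity outweighs all errors. -/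

noncomputable section

/-! ### Exponential inequalities for independent observations -/

section Exponential

variable {ι : Type*} [Fintype ι] {Ω : ι → Type*} [∀ i, MeasurableSpace (Ω i)]
  (μ : ∀ i, Measure (Ω i)) [∀ i, IsProbabilityMeasure (μ i)]

theorem lintegral_pi_prod_eq_prod (f : ∀ i, Ω i → ℝ≥0∞) (hf : ∀ i, Measurable (f i)) :
    ∫⁻ ω, ∏ i, f i (ω i) ∂(Measure.pi μ) = ∏ i, ∫⁻ y, f i y ∂(μ i) := by
  rw [ProbabilityTheory.lintegral_prod_eq_prod_lintegral_of_indepFun Finset.univ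
    (fun i (ω : ∀ i, Ω i) => f i (ω i))
    (ProbabilityTheory.iIndepFun_pi fun i => (hf i).aemeasurable)
    (fun i => (hf i).comp (measurable_pi_apply i))]
  refine Finset.prod_congr rfl fun i _ => ?_
  exact (measurePreserving_eval μ i).lintegral_comp (hf i)

/-- Chernoff's bound for sums of independent variables. -/
theorem pi_chernoff (f : ∀ i, Ω i → ℝ) (hf : ∀ i, Measurable (f i)) (a : ι → ℝ)
    (h : ∀ i, ∫⁻ y, ENNReal.ofReal (Real.exp (f i y)) ∂(μ i) ≤ ENNReal.ofReal (Real.exp (a i)))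
    (b : ℝ) :
    Measure.pi μ {ω | ∑ i, a i + b ≤ ∑ i, f i (ω i)} ≤ ENNReal.ofReal (Real.exp (-b)) := by
  have hm : ∀ i, Measurable fun y => ENNReal.ofReal (Real.exp (f i y)) := fun i =>
    (Real.measurable_exp.comp (hf i)).ennreal_ofReal
  have h1 : ∫⁻ ω, ∏ i, ENNReal.ofReal (Real.exp (f i (ω i))) ∂(Measure.pi μ)
      ≤ ENNReal.ofReal (Real.exp (∑ i, a i)) := by
    rw [lintegral_pi_prod_eq_prod μ _ hm, Real.exp_sum,
      ENNReal.ofReal_prod_of_nonneg fun i _ => (Real.exp_pos _).le]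
    exact Finset.prod_le_prod' fun i _ => h i
  have hM : Measurable fun ω : (∀ i, Ω i) => ∏ i, ENNReal.ofReal (Real.exp (f i (ω i))) :=
    Finset.measurable_prod _ fun i _ => (hm i).comp (measurable_pi_apply i)
  have h2 := meas_ge_le_lintegral_div (μ := Measure.pi μ) hM.aemeasurable
    (ε := ENNReal.ofReal (Real.exp (∑ i, a i + b)))
    (by simpa using Real.exp_pos _) ENNReal.ofReal_ne_top
  refine (measure_mono fun ω hω => ?_).trans (h2.trans ?_)
  · simp only [Set.mem_ofPred_eq] at hω ⊢
    rw [← ENNReal.ofReal_prod_of_nonneg fun i _ => (Real.exp_pos _).le, ← Real.exp_sum]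
    exact ENNReal.ofReal_le_ofReal (Real.exp_le_exp.2 hω)
  · refine (ENNReal.div_le_div_right h1 _).trans ?_
    rw [← ENNReal.ofReal_div_of_pos (Real.exp_pos _), ← Real.exp_sub]
    apply le_of_eq
    congr 2
    ring

/-- The product `(1 + z + z²/2)(1 - z + z²/2)` equals `1 + z⁴/4`, which is at least `1`. -/
theorem Real.exp_neg_le_of_nonneg {z : ℝ} (hz : 0 ≤ z) : Real.exp (-z) ≤ 1 - z + z ^ 2 / 2 := by
  have h := Real.quadratic_le_exp_of_nonneg hz
  rw [Real.exp_neg]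
  have hp : 0 < 1 + z + z ^ 2 / 2 := by positivity
  refine (inv_anti₀ hp h).trans ?_
  rw [inv_eq_one_div, div_le_iff₀ hp]
  nlinarith [sq_nonneg (z ^ 2)]

/-- The lower tail of a sum of independent nonnegative variables is sub-Gaussian, with the second
moments as variance proxy. -/
theorem pi_lower_tail (W : ∀ i, Ω i → ℝ) (hW : ∀ i, Measurable (W i)) (h0 : ∀ i y, 0 ≤ W i y)
    (hsq : ∀ i, Integrable (fun y => W i y ^ 2) (μ i)) {V : ℝ} (hV : 0 < V)
    (hWV : ∑ i, ∫ y, W i y ^ 2 ∂(μ i) ≤ V) {x : ℝ} (hx : 0 ≤ x) :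
    Measure.pi μ {ω | ∑ i, W i (ω i) ≤ ∑ i, ∫ y, W i y ∂(μ i) - x}
      ≤ ENNReal.ofReal (Real.exp (-(x ^ 2 / (2 * V)))) := by
  -- The minimizer of the Chernoff exponent `-c x + c² V / 2`.
  set c : ℝ := x / V with hc
  have hc0 : 0 ≤ c := by positivity
  have hintg : ∀ i, Integrable (W i) (μ i) := fun i =>
    ((memLp_two_iff_integrable_sq (hW i).aestronglyMeasurable).2 (hsq i)).integrable one_le_two
  have key := pi_chernoff μ (fun i y => -(c * W i y)) (fun i => ((hW i).const_mul c).neg)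
    (fun i => -(c * ∫ y, W i y ∂(μ i)) + c ^ 2 * (∫ y, W i y ^ 2 ∂(μ i)) / 2) (fun i => by
      have hle : ∀ y, Real.exp (-(c * W i y)) ≤ 1 - c * W i y + c ^ 2 * W i y ^ 2 / 2 := fun y => by
        refine (Real.exp_neg_le_of_nonneg (mul_nonneg hc0 (h0 i y))).trans (le_of_eq ?_)
        ring
      have hI1 : Integrable (fun y => 1 - c * W i y) (μ i) :=
        (integrable_const _).sub ((hintg i).const_mul c)
      have hI2 : Integrable (fun y => c ^ 2 * W i y ^ 2 / 2) (μ i) :=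
        ((hsq i).const_mul _).div_const _
      have hI : Integrable (fun y => 1 - c * W i y + c ^ 2 * W i y ^ 2 / 2) (μ i) := hI1.add hI2
      calc ∫⁻ y, ENNReal.ofReal (Real.exp (-(c * W i y))) ∂(μ i)
          ≤ ∫⁻ y, ENNReal.ofReal (1 - c * W i y + c ^ 2 * W i y ^ 2 / 2) ∂(μ i) :=
            lintegral_mono fun y => ENNReal.ofReal_le_ofReal (hle y)
        _ = ENNReal.ofReal (∫ y, (1 - c * W i y + c ^ 2 * W i y ^ 2 / 2) ∂(μ i)) :=
            (ofReal_integral_eq_lintegral_ofReal hI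
              (ae_of_all _ fun y => (Real.exp_pos _).le.trans (hle y))).symm
        _ ≤ _ := by
            apply ENNReal.ofReal_le_ofReal
            rw [integral_add hI1 hI2, integral_sub (integrable_const _)
              ((hintg i).const_mul c), integral_div, integral_const_mul, integral_const_mul]
            simp only [integral_const, probReal_univ, smul_eq_mul, mul_one]
            refine le_trans (le_of_eq ?_) (Real.add_one_le_exp _)
            ring) (x ^ 2 / (2 * V))
  refine (measure_mono fun ω hω => ?_).trans key
  simp only [Set.mem_ofPred_eq] at hω ⊢
  rw [Finset.sum_add_distrib, Finset.sum_neg_distrib, Finset.sum_neg_distrib, ← Finset.mul_sum,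
    ← Finset.mul_sum, ← Finset.sum_div, ← Finset.mul_sum]
  have h1 := mul_le_mul_of_nonneg_left hω hc0
  have h2 := mul_le_mul_of_nonneg_left hWV (sq_nonneg c)
  have h3 : c ^ 2 * V / 2 + x ^ 2 / (2 * V) = c * x := by
    rw [hc]; field_simp; ring
  linarith

end Exponential

/-! ### A concave majorant of the logarithm -/

/-- `logMaj x = 64 * log ((63 + x) / 64)` majorizes `log`, and is Lipschitz on `[0, ∞)`. -/
def logMaj (x : ℝ) : ℝ := 64 * Real.log ((63 + x) / 64)

theorem measurable_logMaj : Measurable logMaj := by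
  unfold logMaj
  exact (Real.measurable_log.comp ((measurable_const.add measurable_id).div_const _)).const_mul _

/-- The reason for the form of `logMaj`: an exponential moment becomes a first moment. -/
theorem exp_logMaj_div {x : ℝ} (hx : 0 ≤ x) : Real.exp (logMaj x / 64) = (63 + x) / 64 := by
  rw [logMaj, mul_div_cancel_left₀ _ (by norm_num), Real.exp_log (by positivity)]

/-- Bernoulli's inequality for `(1 + (x - 1)/64)^64`. -/
theorem le_exp_logMaj {x : ℝ} (hx : 0 ≤ x) : x ≤ Real.exp (logMaj x) := by
  have h : Real.exp (logMaj x) = ((63 + x) / 64) ^ 64 := by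
    rw [← exp_logMaj_div hx, ← Real.exp_nat_mul]
    congr 1
    push_cast
    ring
  have hb := one_add_mul_le_pow (a := (x - 1) / 64) (by linarith) 64
  rw [h]
  calc x = 1 + ((64 : ℕ) : ℝ) * ((x - 1) / 64) := by push_cast; ring
    _ ≤ _ := hb
    _ = _ := by congr 1; ring

theorem logMaj_le_sub_one {x : ℝ} (hx : 0 ≤ x) : logMaj x ≤ x - 1 := by
  have := Real.log_le_sub_one_of_pos (x := (63 + x) / 64) (by positivity)
  unfold logMaj
  linarith

theorem logMaj_mono {x y : ℝ} (hx : 0 ≤ x) (hxy : x ≤ y) : logMaj x ≤ logMaj y := by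
  unfold logMaj
  have : Real.log ((63 + x) / 64) ≤ Real.log ((63 + y) / 64) :=
    Real.log_le_log (by positivity) (by linarith)
  linarith

theorem logMaj_sub_le {x y : ℝ} (hx : 0 ≤ x) (hxy : x ≤ y) :
    logMaj y - logMaj x ≤ 2 * (y - x) := by
  unfold logMaj
  have hy : 0 ≤ y := hx.trans hxy
  have h1 : Real.log ((63 + y) / 64) - Real.log ((63 + x) / 64) = Real.log ((63 + y) / (63 + x)) := by
    rw [← Real.log_div (by positivity) (by positivity)]
    congr 1
    field_simp
  have h2 := Real.log_le_sub_one_of_pos (x := (63 + y) / (63 + x)) (by positivity)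
  have h3 : (63 + y) / (63 + x) - 1 = (y - x) / (63 + x) := by field_simp; ring
  have h4 : (y - x) / (63 + x) ≤ (y - x) / 63 :=
    div_le_div_of_nonneg_left (by linarith) (by norm_num) (by linarith)
  linarith

/-- The size of this error is why `64` is large: on a shell of radius `R` it will cost `4 m R² /
63`, which has to stay below the drift `m R² / 8`. -/
theorem sub_one_sub_logMaj_le {x : ℝ} (hx : 0 ≤ x) : x - 1 - logMaj x ≤ (x - 1) ^ 2 / 63 := by
  have h := Real.one_sub_inv_le_log_of_pos (x := (63 + x) / 64) (by positivity)
  unfold logMaj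
  have h2 : x - 1 - 64 * (1 - ((63 + x) / 64)⁻¹) = (x - 1) ^ 2 / (63 + x) := by
    field_simp; ring
  have h3 : (x - 1) ^ 2 / (63 + x) ≤ (x - 1) ^ 2 / 63 :=
    div_le_div_of_nonneg_left (sq_nonneg _) (by norm_num) (by linarith)
  linarith

theorem abs_logMaj_le {x : ℝ} (hx : 0 ≤ x) : |logMaj x| ≤ 2 * (x + 1) := by
  rw [abs_le]
  have h1 := logMaj_sub_le (le_refl 0) hx
  have h0 : -2 ≤ logMaj 0 := by
    have := sub_one_sub_logMaj_le (le_refl (0:ℝ))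
    linarith
  have h2 := logMaj_mono (le_refl 0) hx
  have h3 := logMaj_le_sub_one hx
  constructor <;> linarith

/-! ### Square-root density ratios and upper brackets. -/

namespace SubsetModel

variable {Θ : Type u} [MeasurableSpace Θ] {m : ℕ} (M : SubsetModel.{u, v} Θ m)

instance (θ : Θ) (i : Fin m) : IsProbabilityMeasure (M.obsLaw θ i) :=
  ⟨by
    rw [obsLaw, withDensity_apply _ MeasurableSet.univ, Measure.restrict_univ]
    exact M.p_lintegral i θ⟩

instance (θ : Θ) : IsProbabilityMeasure (M.law θ) := by
  unfold law; infer_instance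

theorem measurable_p (i : Fin m) (θ : Θ) : Measurable (M.p i θ) :=
  (M.p_measurable i).comp measurable_prodMk_left

theorem integrable_p (i : Fin m) (θ : Θ) : Integrable (M.p i θ) (M.ν i) := by
  refine ⟨(M.measurable_p i θ).aestronglyMeasurable, ?_⟩
  rw [hasFiniteIntegral_iff_ofReal (ae_of_all _ (M.p_nonneg i θ)), M.p_lintegral]
  exact ENNReal.one_lt_top

theorem integral_p (i : Fin m) (θ : Θ) : ∫ y, M.p i θ y ∂(M.ν i) = 1 := by
  rw [integral_eq_lintegral_of_nonneg_ae (ae_of_all _ (M.p_nonneg i θ))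
    (M.measurable_p i θ).aestronglyMeasurable, M.p_lintegral, ENNReal.toReal_one]

theorem integrable_obsLaw_iff (θ : Θ) (i : Fin m) {g : M.obs i → ℝ} :
    Integrable g (M.obsLaw θ i) ↔ Integrable (fun y => M.p i θ y * g y) (M.ν i) := by
  unfold obsLaw
  rw [integrable_withDensity_iff_integrable_smul' (M.measurable_p i θ).ennreal_ofReal
    (ae_of_all _ fun _ => ENNReal.ofReal_lt_top)]
  simp only [ENNReal.toReal_ofReal (M.p_nonneg i θ _), smul_eq_mul]

theorem integral_obsLaw (θ : Θ) (i : Fin m) (g : M.obs i → ℝ) :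
    ∫ y, g y ∂(M.obsLaw θ i) = ∫ y, M.p i θ y * g y ∂(M.ν i) := by
  unfold obsLaw
  rw [integral_withDensity_eq_integral_toReal_smul (M.measurable_p i θ).ennreal_ofReal
    (ae_of_all _ fun _ => ENNReal.ofReal_lt_top)]
  simp only [ENNReal.toReal_ofReal (M.p_nonneg i θ _), smul_eq_mul]

theorem ae_p_pos (θ : Θ) (i : Fin m) : ∀ᵐ y ∂(M.obsLaw θ i), 0 < M.p i θ y := by
  unfold obsLaw
  rw [ae_withDensity_iff (M.measurable_p i θ).ennreal_ofReal]
  refine ae_of_all _ fun y hy => ?_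
  simpa using hy

/-- Families of integrable nonnegative functions, such as the upper ends of brackets. -/
structure Admissible (a : ∀ i, M.obs i → ℝ) : Prop where
  measurable : ∀ i, Measurable (a i)
  nonneg : ∀ i y, 0 ≤ a i y
  integrable : ∀ i, Integrable (a i) (M.ν i)

theorem admissible_p (θ : Θ) : M.Admissible fun i => M.p i θ :=
  ⟨fun i => M.measurable_p i θ, fun i => M.p_nonneg i θ, fun i => M.integrable_p i θ⟩

/-- The square root of the ratio of `a` to the density under `θ`. -/
def sqrtRatio (θ : Θ) (a : ∀ i, M.obs i → ℝ) (i : Fin m) (y : M.obs i) : ℝ :=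
  Real.sqrt (a i y) / Real.sqrt (M.p i θ y)

variable {M}

namespace Admissible

variable {a b : ∀ i, M.obs i → ℝ}

theorem measurable_sqrt (ha : M.Admissible a) (i : Fin m) : Measurable fun y => Real.sqrt (a i y) :=
  (ha.measurable i).sqrt

theorem memLp_sqrt (ha : M.Admissible a) (i : Fin m) : MemLp (fun y => Real.sqrt (a i y)) 2 (M.ν i) := by
  rw [memLp_two_iff_integrable_sq (ha.measurable_sqrt i).aestronglyMeasurable]
  simpa only [Real.sq_sqrt (ha.nonneg i _)] using ha.integrable i

theorem integrable_sqrt_sub_sq (ha : M.Admissible a) (hb : M.Admissible b) (i : Fin m) :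
    Integrable (fun y => (Real.sqrt (a i y) - Real.sqrt (b i y)) ^ 2) (M.ν i) :=
  ((ha.memLp_sqrt i).sub (hb.memLp_sqrt i)).integrable_sq

theorem integrable_sqrt_mul_sqrt (ha : M.Admissible a) (hb : M.Admissible b) (i : Fin m) :
    Integrable (fun y => Real.sqrt (a i y) * Real.sqrt (b i y)) (M.ν i) :=
  (ha.memLp_sqrt i).integrable_mul (hb.memLp_sqrt i)

theorem measurable_sqrtRatio (ha : M.Admissible a) (θ : Θ) (i : Fin m) : Measurable (M.sqrtRatio θ a i) :=
  (ha.measurable_sqrt i).div (M.measurable_p i θ).sqrt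

theorem sqrtRatio_nonneg (θ : Θ) (a : ∀ i, M.obs i → ℝ) (i : Fin m) (y : M.obs i) :
    0 ≤ M.sqrtRatio θ a i y :=
  div_nonneg (Real.sqrt_nonneg _) (Real.sqrt_nonneg _)

theorem sqrtRatio_le {a b : ∀ i, M.obs i → ℝ} (θ : Θ) {i : Fin m} {y : M.obs i}
    (h : a i y ≤ b i y) : M.sqrtRatio θ a i y ≤ M.sqrtRatio θ b i y :=
  div_le_div_of_nonneg_right (Real.sqrt_le_sqrt h) (Real.sqrt_nonneg _)

/-- Equality can fail only where the density under `θ` vanishes: the left side is `0` there, but `a`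
and `b` may still differ. -/
theorem p_mul_sqrtRatio_sub_sq_le (θ : Θ) (a b : ∀ i, M.obs i → ℝ) (i : Fin m) (y : M.obs i) :
    M.p i θ y * (M.sqrtRatio θ a i y - M.sqrtRatio θ b i y) ^ 2
      ≤ (Real.sqrt (a i y) - Real.sqrt (b i y)) ^ 2 := by
  rcases (M.p_nonneg i θ y).eq_or_lt with h | h
  · rw [← h, zero_mul]; positivity
  · have hs := Real.sqrt_pos.2 h
    apply le_of_eq
    unfold sqrtRatio
    nth_rewrite 1 [← Real.sq_sqrt h.le]
    field_simp

theorem p_mul_sqrtRatio (θ : Θ) (a : ∀ i, M.obs i → ℝ) (i : Fin m) (y : M.obs i) :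
    M.p i θ y * M.sqrtRatio θ a i y = Real.sqrt (a i y) * Real.sqrt (M.p i θ y) := by
  rcases (M.p_nonneg i θ y).eq_or_lt with h | h
  · rw [← h]; simp
  · have hs := Real.sqrt_pos.2 h
    unfold sqrtRatio
    nth_rewrite 1 [← Real.sq_sqrt h.le]
    field_simp

theorem integrable_sqrtRatio_sub_sq (ha : M.Admissible a) (hb : M.Admissible b) (θ : Θ) (i : Fin m) :
    Integrable (fun y => (M.sqrtRatio θ a i y - M.sqrtRatio θ b i y) ^ 2) (M.obsLaw θ i) := by
  rw [M.integrable_obsLaw_iff]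
  refine (ha.integrable_sqrt_sub_sq hb i).mono'
    ((M.measurable_p i θ).mul (((ha.measurable_sqrtRatio θ i).sub
      (hb.measurable_sqrtRatio θ i)).pow_const 2)).aestronglyMeasurable (ae_of_all _ fun y => ?_)
  rw [Real.norm_of_nonneg (mul_nonneg (M.p_nonneg i θ y) (sq_nonneg _))]
  exact p_mul_sqrtRatio_sub_sq_le θ a b i y

theorem integral_sqrtRatio_sub_sq_le (ha : M.Admissible a) (hb : M.Admissible b) (θ : Θ) (i : Fin m) :
    ∫ y, (M.sqrtRatio θ a i y - M.sqrtRatio θ b i y) ^ 2 ∂(M.obsLaw θ i)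
      ≤ ∫ y, (Real.sqrt (a i y) - Real.sqrt (b i y)) ^ 2 ∂(M.ν i) := by
  rw [M.integral_obsLaw]
  exact integral_mono ((M.integrable_obsLaw_iff θ i).1 (ha.integrable_sqrtRatio_sub_sq hb θ i))
    (ha.integrable_sqrt_sub_sq hb i) fun y => p_mul_sqrtRatio_sub_sq_le θ a b i y

theorem integrable_sqrtRatio (ha : M.Admissible a) (θ : Θ) (i : Fin m) :
    Integrable (M.sqrtRatio θ a i) (M.obsLaw θ i) := by
  rw [M.integrable_obsLaw_iff]
  simp only [p_mul_sqrtRatio]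
  exact ha.integrable_sqrt_mul_sqrt (M.admissible_p θ) i

theorem sqrtRatio_self_ae (θ : Θ) (i : Fin m) :
    ∀ᵐ y ∂(M.obsLaw θ i), M.sqrtRatio θ (fun i => M.p i θ) i y = 1 := by
  filter_upwards [M.ae_p_pos θ i] with y hy
  exact div_self (Real.sqrt_pos.2 hy).ne'

theorem integrable_sqrtRatio_sub_one_sq (ha : M.Admissible a) (θ : Θ) (i : Fin m) :
    Integrable (fun y => (M.sqrtRatio θ a i y - 1) ^ 2) (M.obsLaw θ i) := by
  refine (integrable_congr ?_).1 (ha.integrable_sqrtRatio_sub_sq (M.admissible_p θ) θ i)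
  filter_upwards [sqrtRatio_self_ae θ i] with y hy
  rw [hy]

theorem integral_sqrtRatio_sub_one_sq_le (ha : M.Admissible a) (θ : Θ) (i : Fin m) :
    ∫ y, (M.sqrtRatio θ a i y - 1) ^ 2 ∂(M.obsLaw θ i)
      ≤ ∫ y, (Real.sqrt (a i y) - Real.sqrt (M.p i θ y)) ^ 2 ∂(M.ν i) := by
  refine (integral_congr_ae ?_).trans_le
    (ha.integral_sqrtRatio_sub_sq_le (M.admissible_p θ) θ i)
  filter_upwards [sqrtRatio_self_ae θ i] with y hy
  rw [hy]

theorem integrable_logMaj (ha : M.Admissible a) (θ : Θ) (i : Fin m) :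
    Integrable (fun y => logMaj (M.sqrtRatio θ a i y)) (M.obsLaw θ i) := by
  refine Integrable.mono' (((ha.integrable_sqrtRatio θ i).add (integrable_const (1 : ℝ))).const_mul 2)
    (measurable_logMaj.comp (ha.measurable_sqrtRatio θ i)).aestronglyMeasurable
    (ae_of_all _ fun y => ?_)
  exact abs_logMaj_le (sqrtRatio_nonneg θ a i y)

end Admissible

/-- Both sides are the Hellinger affinity, the right one after expanding the square. This is the
source of the negative drift. -/
theorem integral_sqrtRatio_p (θ₀ θ : Θ) (i : Fin m) :
    ∫ y, M.sqrtRatio θ₀ (fun i => M.p i θ) i y ∂(M.obsLaw θ₀ i)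
      = 1 - (∫ y, (Real.sqrt (M.p i θ y) - Real.sqrt (M.p i θ₀ y)) ^ 2 ∂(M.ν i)) / 2 := by
  rw [M.integral_obsLaw]
  simp only [Admissible.p_mul_sqrtRatio]
  have h : ∀ y, (Real.sqrt (M.p i θ y) - Real.sqrt (M.p i θ₀ y)) ^ 2
      = M.p i θ y + M.p i θ₀ y - 2 * (Real.sqrt (M.p i θ y) * Real.sqrt (M.p i θ₀ y)) := by
    intro y
    rw [sub_sq, Real.sq_sqrt (M.p_nonneg i θ y), Real.sq_sqrt (M.p_nonneg i θ₀ y)]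
    ring
  have h1 : Integrable (fun y => M.p i θ y + M.p i θ₀ y) (M.ν i) :=
    (M.integrable_p i θ).add (M.integrable_p i θ₀)
  simp only [h]
  rw [integral_sub h1 (((M.admissible_p θ).integrable_sqrt_mul_sqrt (M.admissible_p θ₀) i).const_mul 2),
    integral_add (M.integrable_p i θ) (M.integrable_p i θ₀), M.integral_p, M.integral_p,
    integral_const_mul]
  ring

theorem sum_integral_eq_hell_sq (hm : 0 < m) (θ θ' : Θ) :
    ∑ i, ∫ y, (Real.sqrt (M.p i θ y) - Real.sqrt (M.p i θ' y)) ^ 2 ∂(M.ν i)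
      = m * M.hell θ θ' ^ 2 := by
  have hm' : (m : ℝ) ≠ 0 := by positivity
  unfold hell
  rw [Real.sq_sqrt (mul_nonneg (by positivity)
    (Finset.sum_nonneg fun i _ => integral_nonneg fun y => sq_nonneg _))]
  field_simp

theorem hell_sq_le_two (hm : 0 < m) (θ θ' : Θ) : M.hell θ θ' ^ 2 ≤ 2 := by
  have h1 : ∀ i, ∫ y, (Real.sqrt (M.p i θ y) - Real.sqrt (M.p i θ' y)) ^ 2 ∂(M.ν i) ≤ 2 := by
    intro i
    have h := integral_sqrtRatio_p (M := M) θ' θ i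
    have h2 : 0 ≤ ∫ y, M.sqrtRatio θ' (fun i => M.p i θ) i y ∂(M.obsLaw θ' i) :=
      integral_nonneg fun y => Admissible.sqrtRatio_nonneg _ _ _ _
    linarith
  have h2 := Finset.sum_le_sum fun i (_ : i ∈ Finset.univ) => h1 i
  rw [sum_integral_eq_hell_sq hm] at h2
  simp only [Finset.sum_const, Finset.card_univ, Fintype.card_fin, nsmul_eq_mul] at h2
  have hm' : (0 : ℝ) < m := by positivity
  nlinarith

/-- The family `a` bounds the densities under `θ` from above, at Hellinger distance at most `δ`. -/
structure UpperApprox (M : SubsetModel.{u, v} Θ m) (θ : Θ) (δ : ℝ) (a : ∀ i, M.obs i → ℝ) :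
    Prop extends M.Admissible a where
  le : ∀ i y, M.p i θ y ≤ a i y
  sum_le : ∑ i, ∫ y, (Real.sqrt (a i y) - Real.sqrt (M.p i θ y)) ^ 2 ∂(M.ν i) ≤ m * δ ^ 2

/-- The minimum is squeezed between the density and `b`, so it inherits the accuracy of `b`; it also
stays below `a`, which makes chains of minima monotone. -/
theorem UpperApprox.inf {θ : Θ} {δ δ' : ℝ} {a b : ∀ i, M.obs i → ℝ} (ha : M.UpperApprox θ δ a)
    (hb : M.UpperApprox θ δ' b) : M.UpperApprox θ δ' (fun i y => min (a i y) (b i y)) := by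
  have hA : M.Admissible (fun i y => min (a i y) (b i y)) :=
    ⟨fun i => (ha.measurable i).min (hb.measurable i), fun i y => le_min (ha.nonneg i y) (hb.nonneg i y),
      fun i => (ha.integrable i).inf (hb.integrable i)⟩
  refine ⟨hA, fun i y => le_min (ha.le i y) (hb.le i y), le_trans ?_ hb.sum_le⟩
  refine Finset.sum_le_sum fun i _ => integral_mono (hA.integrable_sqrt_sub_sq (M.admissible_p θ) i)
    (hb.toAdmissible.integrable_sqrt_sub_sq (M.admissible_p θ) i) fun y => ?_
  have h1 := Real.sqrt_le_sqrt (le_min (ha.le i y) (hb.le i y))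
  have h2 := Real.sqrt_le_sqrt (min_le_right (a i y) (b i y))
  exact pow_le_pow_left₀ (by linarith) (by linarith) 2

/-- The lower end serves only to bound `√u - √p` by `√u - √l`. Integrability of the upper end
follows from `u ≤ 2 (√u - √p)² + 2 p`. -/
theorem IsBracketing.upperApprox (hm : 0 < m) {Ξ : Set Θ} {δ : ℝ} {N : ℕ}
    {l u : Fin N → ∀ i, M.obs i → ℝ} (h : M.IsBracketing Ξ δ l u) {θ : Θ} (hθ : θ ∈ Ξ) :
    ∃ s, M.UpperApprox θ δ (u s) := by
  obtain ⟨h1, h2, h3⟩ := h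
  obtain ⟨s, hs⟩ := h3 θ hθ
  refine ⟨s, ?_⟩
  have hle : ∀ i y, (Real.sqrt (u s i y) - Real.sqrt (M.p i θ y)) ^ 2
      ≤ (Real.sqrt (u s i y) - Real.sqrt (l s i y)) ^ 2 := fun i y => by
    have e1 := Real.sqrt_le_sqrt (hs i y).1
    have e2 := Real.sqrt_le_sqrt (hs i y).2
    exact pow_le_pow_left₀ (by linarith) (by linarith) 2
  have hm0 : (m : ℝ≥0∞) ≠ 0 := by exact_mod_cast hm.ne'
  have hsum : ∑ i, ∫⁻ y, ENNReal.ofReal ((Real.sqrt (u s i y) - Real.sqrt (M.p i θ y)) ^ 2) ∂(M.ν i)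
      ≤ ENNReal.ofReal (m * δ ^ 2) := by
    have h4 := mul_le_mul_right (h2 s) (m : ℝ≥0∞)
    rw [← mul_assoc, ENNReal.mul_inv_cancel hm0 (ENNReal.natCast_ne_top m), one_mul] at h4
    rw [ENNReal.ofReal_mul (by positivity), ENNReal.ofReal_natCast]
    exact (Finset.sum_le_sum fun i _ => lintegral_mono fun y =>
      ENNReal.ofReal_le_ofReal (hle i y)).trans h4
  have hmeas : ∀ i, Measurable fun y => (Real.sqrt (u s i y) - Real.sqrt (M.p i θ y)) ^ 2 := fun i =>
    (((h1 s i).2.1.sqrt).sub (M.measurable_p i θ).sqrt).pow_const 2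
  have hfin : ∀ i, ∫⁻ y, ENNReal.ofReal ((Real.sqrt (u s i y) - Real.sqrt (M.p i θ y)) ^ 2) ∂(M.ν i)
      ≠ ∞ := fun i => ne_top_of_le_ne_top ENNReal.ofReal_ne_top
    ((Finset.single_le_sum (f := fun i => ∫⁻ y, ENNReal.ofReal
      ((Real.sqrt (u s i y) - Real.sqrt (M.p i θ y)) ^ 2) ∂(M.ν i)) (fun _ _ => zero_le)
      (Finset.mem_univ i)).trans hsum)
  have hsqint : ∀ i, Integrable (fun y => (Real.sqrt (u s i y) - Real.sqrt (M.p i θ y)) ^ 2) (M.ν i) :=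
    fun i => ⟨(hmeas i).aestronglyMeasurable, by
      rw [hasFiniteIntegral_iff_ofReal (ae_of_all _ fun _ => sq_nonneg _)]
      exact (hfin i).lt_top⟩
  have hnn : ∀ i y, 0 ≤ u s i y := fun i y => (M.p_nonneg i θ y).trans (hs i y).2
  refine ⟨⟨fun i => (h1 s i).2.1, hnn, fun i => ?_⟩, fun i y => (hs i y).2, ?_⟩
  · refine (((hsqint i).const_mul 2).add ((M.integrable_p i θ).const_mul 2)).mono'
      (h1 s i).2.1.aestronglyMeasurable (ae_of_all _ fun y => ?_)
    rw [Real.norm_of_nonneg (hnn i y)]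
    simp only [Pi.add_apply]
    nlinarith [sq_nonneg (Real.sqrt (u s i y) - 2 * Real.sqrt (M.p i θ y)),
      Real.sq_sqrt (hnn i y), Real.sq_sqrt (M.p_nonneg i θ y)]
  · have h5 : ∀ i, ∫ y, (Real.sqrt (u s i y) - Real.sqrt (M.p i θ y)) ^ 2 ∂(M.ν i)
        = (∫⁻ y, ENNReal.ofReal ((Real.sqrt (u s i y) - Real.sqrt (M.p i θ y)) ^ 2) ∂(M.ν i)).toReal :=
      fun i => integral_eq_lintegral_of_nonneg_ae (ae_of_all _ fun _ => sq_nonneg _)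
        (hmeas i).aestronglyMeasurable
    simp only [h5]
    rw [← ENNReal.toReal_sum fun i _ => hfin i]
    exact ENNReal.toReal_le_of_le_ofReal (by positivity) hsum

end SubsetModel

/-! ### Union bounds, dyadic sums and tail bounds for the chaining. -/

theorem measure_biUnion_finset_le_card_mul {Ω F : Type*} [MeasurableSpace Ω] (μ : Measure Ω)
    (S : Finset F) (E : F → Set Ω) (c : ℝ≥0∞) (h : ∀ a ∈ S, μ (E a) ≤ c) :
    μ (⋃ a ∈ S, E a) ≤ S.card * c := by
  refine (measure_biUnion_finset_le S E).trans ((Finset.sum_le_card_nsmul S _ c h).trans ?_)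
  rw [nsmul_eq_mul]

/-- A dyadic sum of partial sums is dominated by the dyadic sum of the terms. -/
theorem sum_dyadic_mul_partial_sum (c : ℝ) (s : ℕ → ℝ) (n : ℕ) :
    ∑ k ∈ Finset.range n, c / 2 ^ k * ∑ j ∈ Finset.range (k + 2), s j
      + 2 * (c / 2 ^ n) * ∑ j ∈ Finset.range (n + 1), s j
      ≤ 4 * ∑ j ∈ Finset.range (n + 1), c / 2 ^ j * s j - 2 * c * s 0 := by
  -- The second term on the left and the last one on the right turn the induction into an identity,
  -- so no sign of `s` is needed.
  induction n with
  | zero => simp; linarith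
  | succ n ih =>
    rw [Finset.sum_range_succ, Finset.sum_range_succ (n := n + 1), Finset.sum_range_succ (n := n + 1)
      (f := fun j => c / 2 ^ j * s j)]
    have h : c / 2 ^ (n + 1) = c / 2 ^ n / 2 := by rw [pow_succ]; field_simp
    rw [h]
    linarith

theorem sum_dyadic_le {c : ℝ} (hc : 0 ≤ c) (n : ℕ) :
    ∑ k ∈ Finset.range n, c / 2 ^ k ≤ 2 * c := by
  have h : ∑ k ∈ Finset.range n, c / 2 ^ k = 2 * c - 2 * (c / 2 ^ n) := by
    induction n with
    | zero => simp
    | succ n ih => rw [Finset.sum_range_succ, ih, pow_succ]; field_simp; ring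
  have : 0 ≤ c / 2 ^ n := by positivity
  linarith

namespace SubsetModel

variable {Θ : Type u} [MeasurableSpace Θ] {m : ℕ} {M : SubsetModel.{u, v} Θ m}

/-- Chernoff at the parameter `1/64`, where the exponential moment is exactly `1 + (E - 1)/64`, with
`E` the mean of the ratio. -/
theorem Admissible.start_tail {a : ∀ i, M.obs i → ℝ} (ha : M.Admissible a) (θ₀ : Θ) (t : ℝ) :
    M.law θ₀ {y | ∑ i, (∫ z, M.sqrtRatio θ₀ a i z ∂(M.obsLaw θ₀ i) - 1) + t
      ≤ ∑ i, logMaj (M.sqrtRatio θ₀ a i (y i))} ≤ ENNReal.ofReal (Real.exp (-(t / 64))) := by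
  have key := pi_chernoff (M.obsLaw θ₀) (fun i y => logMaj (M.sqrtRatio θ₀ a i y) / 64)
    (fun i => (measurable_logMaj.comp (ha.measurable_sqrtRatio θ₀ i)).div_const _)
    (fun i => (∫ z, M.sqrtRatio θ₀ a i z ∂(M.obsLaw θ₀ i) - 1) / 64) (fun i => by
      simp only [exp_logMaj_div (Admissible.sqrtRatio_nonneg _ _ _ _)]
      have hI : Integrable (fun y => (63 + M.sqrtRatio θ₀ a i y) / 64) (M.obsLaw θ₀ i) :=
        ((integrable_const _).add (ha.integrable_sqrtRatio θ₀ i)).div_const _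
      rw [← ofReal_integral_eq_lintegral_ofReal hI (ae_of_all _ fun y => by
        have := Admissible.sqrtRatio_nonneg θ₀ a i y
        positivity)]
      apply ENNReal.ofReal_le_ofReal
      rw [integral_div, integral_add (integrable_const _) (ha.integrable_sqrtRatio θ₀ i)]
      simp only [integral_const, probReal_univ, smul_eq_mul, one_mul]
      refine le_trans (le_of_eq ?_) (Real.add_one_le_exp _)
      ring) (t / 64)
  refine (measure_mono fun y hy => ?_).trans key
  simp only [Set.mem_ofPred_eq] at hy ⊢
  rw [← Finset.sum_div, ← Finset.sum_div]
  linarith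

/-- The loss of `logMaj ∘ sqrtRatio` when `a` is replaced by its minimum with `b`. -/
def refineLoss (M : SubsetModel.{u, v} Θ m) (θ₀ : Θ) (a b : ∀ i, M.obs i → ℝ) (i : Fin m)
    (y : M.obs i) : ℝ :=
  logMaj (M.sqrtRatio θ₀ a i y) - logMaj (M.sqrtRatio θ₀ (fun i y => min (a i y) (b i y)) i y)

/-- The minimum lies between the density under `θ` and `a`, so the loss is at most `2 (√a - √p_θ) /
√p_θ₀` where `p_θ₀ > 0`, with second moments summing to at most `4 m δ²`. Being nonnegative, it has
a sub-Gaussian lower tail. -/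
theorem UpperApprox.refine_tail (hm : 0 < m) {θ : Θ} {δ δ' : ℝ} (hδ : 0 < δ)
    {a b : ∀ i, M.obs i → ℝ} (ha : M.UpperApprox θ δ a) (hb : M.UpperApprox θ δ' b) (θ₀ : Θ)
    {x : ℝ} (hx : 0 ≤ x) :
    M.law θ₀ {y | ∑ i, M.refineLoss θ₀ a b i (y i)
      ≤ ∑ i, ∫ z, M.refineLoss θ₀ a b i z ∂(M.obsLaw θ₀ i) - x}
      ≤ ENNReal.ofReal (Real.exp (-(x ^ 2 / (2 * (4 * (m * δ ^ 2)))))) := by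
  have hA := (ha.inf hb).toAdmissible
  have hle : ∀ i y, M.sqrtRatio θ₀ (fun i y => min (a i y) (b i y)) i y ≤ M.sqrtRatio θ₀ a i y :=
    fun i y => Admissible.sqrtRatio_le θ₀ (min_le_left _ _)
  have hmeas : ∀ i, Measurable (M.refineLoss θ₀ a b i) := fun i =>
    (measurable_logMaj.comp (ha.measurable_sqrtRatio θ₀ i)).sub
      (measurable_logMaj.comp (hA.measurable_sqrtRatio θ₀ i))
  have h0 : ∀ i y, 0 ≤ M.refineLoss θ₀ a b i y := fun i y =>
    sub_nonneg.2 (logMaj_mono (Admissible.sqrtRatio_nonneg _ _ _ _) (hle i y))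
  have hsq : ∀ i y, M.refineLoss θ₀ a b i y ^ 2 ≤ 4 * (M.sqrtRatio θ₀ a i y
      - M.sqrtRatio θ₀ (fun i y => min (a i y) (b i y)) i y) ^ 2 := fun i y => by
    have h := pow_le_pow_left₀ (h0 i y)
      (logMaj_sub_le (Admissible.sqrtRatio_nonneg _ _ _ _) (hle i y)) 2
    rw [mul_pow] at h
    linarith
  have hI : ∀ i, Integrable (fun y => 4 * (M.sqrtRatio θ₀ a i y
      - M.sqrtRatio θ₀ (fun i y => min (a i y) (b i y)) i y) ^ 2) (M.obsLaw θ₀ i) := fun i =>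
    (ha.toAdmissible.integrable_sqrtRatio_sub_sq hA θ₀ i).const_mul 4
  have hWsq : ∀ i, Integrable (fun y => M.refineLoss θ₀ a b i y ^ 2) (M.obsLaw θ₀ i) := fun i =>
    (hI i).mono' ((hmeas i).pow_const 2).aestronglyMeasurable (ae_of_all _ fun y => by
      rw [Real.norm_of_nonneg (sq_nonneg _)]
      exact hsq i y)
  have hm' : (0 : ℝ) < m := by exact_mod_cast hm
  refine pi_lower_tail (M.obsLaw θ₀) (M.refineLoss θ₀ a b) hmeas h0 hWsq (by positivity) ?_ hx
  calc ∑ i, ∫ y, M.refineLoss θ₀ a b i y ^ 2 ∂(M.obsLaw θ₀ i)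
      ≤ ∑ i, 4 * ∫ y, (Real.sqrt (a i y) - Real.sqrt (M.p i θ y)) ^ 2 ∂(M.ν i) := by
        refine Finset.sum_le_sum fun i _ => ?_
        refine (integral_mono (hWsq i) (hI i) (hsq i)).trans ?_
        rw [integral_const_mul]
        refine mul_le_mul_of_nonneg_left ((ha.toAdmissible.integral_sqrtRatio_sub_sq_le hA θ₀ i).trans
          ?_) (by norm_num)
        refine integral_mono (ha.toAdmissible.integrable_sqrt_sub_sq hA i)
          (ha.toAdmissible.integrable_sqrt_sub_sq (M.admissible_p θ) i) fun y => ?_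
        have h1 := Real.sqrt_le_sqrt (le_min (ha.le i y) (hb.le i y))
        have h2 := Real.sqrt_le_sqrt (min_le_left (a i y) (b i y))
        exact pow_le_pow_left₀ (by linarith) (by linarith) 2
    _ ≤ 4 * (m * δ ^ 2) := by
        rw [← Finset.mul_sum]
        exact mul_le_mul_of_nonneg_left ha.sum_le (by norm_num)

/-- By `logMaj x ≤ x - 1` the affinity gives the drift. The bracket error `X` enters linearly, and
`X ≤ X²/δ + δ` turns it into `2 δ` per observation. -/
theorem UpperApprox.sum_integral_logMaj_le (hm : 0 < m) {θ : Θ} {δ : ℝ} (hδ : 0 < δ)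
    {a : ∀ i, M.obs i → ℝ} (ha : M.UpperApprox θ δ a) (θ₀ : Θ) :
    ∑ i, ∫ y, logMaj (M.sqrtRatio θ₀ a i y) ∂(M.obsLaw θ₀ i)
      ≤ m * (-(M.hell θ θ₀ ^ 2 / 2) + 2 * δ) := by
  have hp := M.admissible_p θ
  have hle : ∀ i, ∫ y, logMaj (M.sqrtRatio θ₀ a i y) ∂(M.obsLaw θ₀ i)
      ≤ -(∫ y, (Real.sqrt (M.p i θ y) - Real.sqrt (M.p i θ₀ y)) ^ 2 ∂(M.ν i)) / 2
        + δ⁻¹ * ∫ y, (Real.sqrt (a i y) - Real.sqrt (M.p i θ y)) ^ 2 ∂(M.ν i) + δ := by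
    intro i
    have hI1 : Integrable (fun y => M.sqrtRatio θ₀ (fun i => M.p i θ) i y - 1) (M.obsLaw θ₀ i) :=
      (hp.integrable_sqrtRatio θ₀ i).sub (integrable_const _)
    have hI2 := (ha.toAdmissible.integrable_sqrtRatio_sub_sq hp θ₀ i).const_mul δ⁻¹
    have hI3 : Integrable (fun y => M.sqrtRatio θ₀ (fun i => M.p i θ) i y - 1
        + δ⁻¹ * (M.sqrtRatio θ₀ a i y - M.sqrtRatio θ₀ (fun i => M.p i θ) i y) ^ 2)
        (M.obsLaw θ₀ i) := hI1.add hI2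
    have hmono := integral_mono (ha.integrable_logMaj θ₀ i) (hI3.add (integrable_const δ)) fun y => by
      have h1 := logMaj_le_sub_one (Admissible.sqrtRatio_nonneg θ₀ a i y)
      have h2 : M.sqrtRatio θ₀ a i y - M.sqrtRatio θ₀ (fun i => M.p i θ) i y
          ≤ δ⁻¹ * (M.sqrtRatio θ₀ a i y - M.sqrtRatio θ₀ (fun i => M.p i θ) i y) ^ 2 + δ := by
        set X := M.sqrtRatio θ₀ a i y - M.sqrtRatio θ₀ (fun i => M.p i θ) i y
        have h3 : δ⁻¹ * X ^ 2 + δ - X = δ⁻¹ * ((X - δ / 2) ^ 2 + 3 / 4 * δ ^ 2) := by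
          field_simp; ring
        have h4 : 0 ≤ δ⁻¹ * ((X - δ / 2) ^ 2 + 3 / 4 * δ ^ 2) := by positivity
        linarith
      simp only [Pi.add_apply]
      linarith
    refine hmono.trans ?_
    simp only [Pi.add_apply]
    rw [integral_add hI3 (integrable_const δ), integral_add hI1 hI2,
      integral_sub (hp.integrable_sqrtRatio θ₀ i) (integrable_const _), integral_sqrtRatio_p,
      integral_const_mul]
    simp only [integral_const, probReal_univ, smul_eq_mul, one_mul]
    have h5 := mul_le_mul_of_nonneg_left
      (ha.toAdmissible.integral_sqrtRatio_sub_sq_le hp θ₀ i) (inv_pos.2 hδ).le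
    linarith
  refine (Finset.sum_le_sum fun i _ => hle i).trans ?_
  rw [Finset.sum_add_distrib, Finset.sum_add_distrib, ← Finset.sum_div, Finset.sum_neg_distrib,
    ← Finset.mul_sum, sum_integral_eq_hell_sq hm]
  simp only [Finset.sum_const, Finset.card_univ, Fintype.card_fin, nsmul_eq_mul]
  have h6 := mul_le_mul_of_nonneg_left ha.sum_le (inv_pos.2 hδ).le
  have h7 : δ⁻¹ * (m * δ ^ 2) = m * δ := by field_simp
  linarith

/-- Replaces the affine centering of `Admissible.start_tail` by the mean of `logMaj`, so that the
means telescope along the chain. -/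
theorem UpperApprox.sum_integral_sub_one_le (hm : 0 < m) {θ : Θ} {δ : ℝ}
    {a : ∀ i, M.obs i → ℝ} (ha : M.UpperApprox θ δ a) (θ₀ : Θ) :
    ∑ i, (∫ y, M.sqrtRatio θ₀ a i y ∂(M.obsLaw θ₀ i) - 1)
      ≤ ∑ i, ∫ y, logMaj (M.sqrtRatio θ₀ a i y) ∂(M.obsLaw θ₀ i)
        + m * (2 * δ ^ 2 + 2 * M.hell θ θ₀ ^ 2) / 63 := by
  have hp := M.admissible_p θ
  have hp₀ := M.admissible_p θ₀
  have hle : ∀ i, ∫ y, M.sqrtRatio θ₀ a i y ∂(M.obsLaw θ₀ i) - 1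
      ≤ ∫ y, logMaj (M.sqrtRatio θ₀ a i y) ∂(M.obsLaw θ₀ i)
        + (2 * ∫ y, (Real.sqrt (a i y) - Real.sqrt (M.p i θ y)) ^ 2 ∂(M.ν i)
          + 2 * ∫ y, (Real.sqrt (M.p i θ y) - Real.sqrt (M.p i θ₀ y)) ^ 2 ∂(M.ν i)) / 63 := by
    intro i
    have hI1 : Integrable (fun y => M.sqrtRatio θ₀ a i y - 1) (M.obsLaw θ₀ i) :=
      (ha.integrable_sqrtRatio θ₀ i).sub (integrable_const _)
    have hI2 := ha.integrable_logMaj θ₀ i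
    have hI3 := (ha.integrable_sqrtRatio_sub_one_sq θ₀ i).div_const 63
    have h1 := integral_mono hI1 (hI2.add hI3) fun y => by
      have := sub_one_sub_logMaj_le (Admissible.sqrtRatio_nonneg θ₀ a i y)
      simp only [Pi.add_apply]
      linarith
    simp only [Pi.add_apply] at h1
    rw [integral_sub (ha.integrable_sqrtRatio θ₀ i) (integrable_const _), integral_add hI2 hI3,
      integral_div] at h1
    simp only [integral_const, probReal_univ, smul_eq_mul, one_mul] at h1
    have hJ1 := (ha.toAdmissible.integrable_sqrt_sub_sq hp i).const_mul 2
    have hJ2 := (hp.integrable_sqrt_sub_sq hp₀ i).const_mul 2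
    have h2 := integral_mono (ha.toAdmissible.integrable_sqrt_sub_sq hp₀ i) (hJ1.add hJ2) fun y => by
      simp only [Pi.add_apply]
      nlinarith [sq_nonneg (Real.sqrt (a i y) - Real.sqrt (M.p i θ y)
        - (Real.sqrt (M.p i θ y) - Real.sqrt (M.p i θ₀ y)))]
    simp only [Pi.add_apply] at h2
    rw [integral_add hJ1 hJ2, integral_const_mul, integral_const_mul] at h2
    have h3 := ha.integral_sqrtRatio_sub_one_sq_le θ₀ i
    linarith
  refine (Finset.sum_le_sum fun i _ => hle i).trans ?_
  rw [Finset.sum_add_distrib, ← Finset.sum_div, Finset.sum_add_distrib, ← Finset.mul_sum,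
    ← Finset.mul_sum, sum_integral_eq_hell_sq hm]
  have := ha.sum_le
  linarith

/-- A likelihood ratio bound from an upper bound of the densities. -/
theorem UpperApprox.likelihood_le {θ : Θ} {δ : ℝ} {a : ∀ i, M.obs i → ℝ}
    (ha : M.UpperApprox θ δ a) {θ₀ : Θ} {y : M.Data} (hy : ∀ i, 0 < M.p i θ₀ (y i)) {c : ℝ}
    (hc : ∑ i, logMaj (M.sqrtRatio θ₀ a i (y i)) ≤ c) :
    M.likelihood y θ ≤ Real.exp (2 * c) * M.likelihood y θ₀ := by
  have h : ∀ i, M.p i θ (y i)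
      ≤ Real.exp (2 * logMaj (M.sqrtRatio θ₀ a i (y i))) * M.p i θ₀ (y i) := fun i => by
    have hs := Real.sqrt_pos.2 (hy i)
    have h1 : M.p i θ (y i) ≤ M.sqrtRatio θ₀ a i (y i) ^ 2 * M.p i θ₀ (y i) := by
      unfold sqrtRatio
      rw [div_pow, Real.sq_sqrt (hy i).le, Real.sq_sqrt (ha.nonneg i _),
        div_mul_cancel₀ _ (hy i).ne']
      exact ha.le i _
    refine h1.trans (mul_le_mul_of_nonneg_right ?_ (hy i).le)
    rw [two_mul, Real.exp_add, ← sq]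
    exact pow_le_pow_left₀ (Admissible.sqrtRatio_nonneg _ _ _ _)
      (le_exp_logMaj (Admissible.sqrtRatio_nonneg _ _ _ _)) 2
  unfold likelihood
  refine (Finset.prod_le_prod (fun i _ => M.p_nonneg i θ _) fun i _ => h i).trans ?_
  rw [Finset.prod_mul_distrib, ← Real.exp_sum, ← Finset.mul_sum]
  refine mul_le_mul_of_nonneg_right (Real.exp_le_exp.2 (by linarith))
    (Finset.prod_nonneg fun i _ => M.p_nonneg i θ₀ _)

theorem ae_law_p_pos (θ₀ : Θ) : ∀ᵐ y ∂(M.law θ₀), ∀ i, 0 < M.p i θ₀ (y i) := by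
  rw [ae_all_iff]
  intro i
  exact (measurePreserving_eval (M.obsLaw θ₀) i).quasiMeasurePreserving.ae (M.ae_p_pos θ₀ i)

end SubsetModel

/-! ### Chaining on one Hellinger shell. -/

namespace SubsetModel

variable {Θ : Type u} [MeasurableSpace Θ] {m : ℕ} {M : SubsetModel.{u, v} Θ m}

open Classical in
/-- The minima of one family from each of the levels `0, …, k`. -/
def chainSet {Nb : ℕ → ℕ} (b : ∀ j, Fin (Nb j) → ∀ i, M.obs i → ℝ) :
    ℕ → Finset (∀ i, M.obs i → ℝ)
  | 0 => Finset.univ.image (b 0)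
  | k + 1 => Finset.image₂ (fun a c => fun i y => min (a i y) (c i y)) (chainSet b k)
      (Finset.univ.image (b (k + 1)))

theorem card_chainSet_le {Nb : ℕ → ℕ} (b : ∀ j, Fin (Nb j) → ∀ i, M.obs i → ℝ) {H : ℕ → ℝ}
    (hH : ∀ j, (Nb j : ℝ) ≤ Real.exp (H j)) (k : ℕ) :
    ((chainSet b k).card : ℝ) ≤ Real.exp (∑ j ∈ Finset.range (k + 1), H j) := by
  classical
  have h : ∀ j, ((Finset.univ.image (b j)).card : ℝ) ≤ Real.exp (H j) := fun j => by
    refine le_trans ?_ (hH j)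
    have := Finset.card_image_le (s := Finset.univ) (f := b j)
    rw [Finset.card_univ, Fintype.card_fin] at this
    exact_mod_cast this
  induction k with
  | zero => simpa [chainSet] using h 0
  | succ k ih =>
    have h1 := Finset.card_image₂_le (fun a c : ∀ i, M.obs i → ℝ => fun i y => min (a i y) (c i y))
      (chainSet b k) (Finset.univ.image (b (k + 1)))
    rw [Finset.sum_range_succ, Real.exp_add]
    calc ((chainSet b (k + 1)).card : ℝ)
        ≤ ((chainSet b k).card : ℝ) * ((Finset.univ.image (b (k + 1))).card : ℝ) := by
          rw [← Nat.cast_mul]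
          exact_mod_cast h1
      _ ≤ _ := mul_le_mul ih (h (k + 1)) (by positivity) (Real.exp_pos _).le

/-- The likelihood ratio is uniformly small on a Hellinger shell, by one-sided chaining along
brackets at dyadic scales. -/
theorem exists_shell_exceptional_set (hm : 0 < m) (θ₀ : Θ) {R D : ℝ} (hR : 0 < R) (hD : 0 < D)
    (hD1 : D ≤ 1) (N : ℕ) {Nb : ℕ → ℕ} (H : ℕ → ℝ) (hH0 : ∀ j, 0 ≤ H j)
    (hH : ∀ j, (Nb j : ℝ) ≤ Real.exp (H j)) (l b : ∀ j, Fin (Nb j) → ∀ i, M.obs i → ℝ)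
    (hb : ∀ j, M.IsBracketing {θ | M.hell θ θ₀ ≤ R} (D * R / 2 ^ j) (l j) (b j))
    (hS : ∑ j ∈ Finset.range (N + 1), D * R / 2 ^ j * Real.sqrt (H j)
      ≤ D * Real.sqrt m * R ^ 2 / 2 ^ 11)
    (hN : D * R / 2 ^ N ≤ R ^ 2 / 2 ^ 10) :
    ∃ Bad : Set M.Data,
      M.law θ₀ Bad ≤ ENNReal.ofReal ((N + 1) * Real.exp (-(m * R ^ 2 / 2 ^ 20))) ∧
      ∀ y ∉ Bad, ∀ θ, R / 2 ≤ M.hell θ θ₀ → M.hell θ θ₀ ≤ R →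
        M.likelihood y θ ≤ Real.exp (-(m * R ^ 2 / 32)) * M.likelihood y θ₀ := by
  classical
  have hm' : (0 : ℝ) < m := by exact_mod_cast hm
  have hsm2 : Real.sqrt m ^ 2 = m := Real.sq_sqrt hm'.le
  set δ : ℕ → ℝ := fun j => D * R / 2 ^ j with hδdef
  have hδ : ∀ j, 0 < δ j := fun j => by positivity
  have hδ0 : δ 0 = D * R := by simp [hδdef]
  set A : ℕ → ℝ := fun n => ∑ j ∈ Finset.range n, Real.sqrt (H j) with hAdef
  have hA0 : ∀ n, 0 ≤ A n := fun n => Finset.sum_nonneg fun _ _ => Real.sqrt_nonneg _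
  have hHA : ∀ n, ∑ j ∈ Finset.range n, H j ≤ A n ^ 2 := fun n => by
    have := Finset.sum_sq_le_sq_sum_of_nonneg (s := Finset.range n) (f := fun j => Real.sqrt (H j))
      (fun _ _ => Real.sqrt_nonneg _)
    simpa only [Real.sq_sqrt (hH0 _)] using this
  -- Chosen so that the exponent `x k ^ 2 / (8 m δ_k²)` is a perfect square that pays for the
  -- entropies of levels `0, …, k + 1` and leaves `m R² / 2^20`.
  set x : ℕ → ℝ := fun k => Real.sqrt 8 * Real.sqrt m * δ k * (A (k + 2) + Real.sqrt m * R / 2 ^ 10)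
    with hxdef
  have hx0 : ∀ k, 0 ≤ x k := fun k => by
    have := hA0 (k + 2)
    have := hδ k
    positivity
  have hx2 : ∀ k, ∑ j ∈ Finset.range (k + 2), H j + m * R ^ 2 / 2 ^ 20
      ≤ x k ^ 2 / (2 * (4 * (m * δ k ^ 2))) := fun k => by
    have h1 : x k ^ 2 / (2 * (4 * (m * δ k ^ 2))) = (A (k + 2) + Real.sqrt m * R / 2 ^ 10) ^ 2 := by
      have := (hδ k).ne'
      simp only [hxdef, mul_pow]
      rw [hsm2, Real.sq_sqrt (by norm_num : (0:ℝ) ≤ 8)]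
      field_simp
      ring
    have h2 : (A (k + 2) + Real.sqrt m * R / 2 ^ 10) ^ 2 = A (k + 2) ^ 2
        + 2 * A (k + 2) * (Real.sqrt m * R / 2 ^ 10) + m * R ^ 2 / 2 ^ 20 := by
      rw [add_sq, div_pow, mul_pow, hsm2]
      ring
    have h3 : 0 ≤ 2 * A (k + 2) * (Real.sqrt m * R / 2 ^ 10) := by
      have := hA0 (k + 2)
      positivity
    have := hHA (k + 2)
    linarith
  have hxsum : ∑ k ∈ Finset.range N, x k ≤ 3 * (m * R ^ 2) / 2 ^ 8 := by
    have h1 : ∑ k ∈ Finset.range N, x k = Real.sqrt 8 * Real.sqrt m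
        * (∑ k ∈ Finset.range N, δ k * A (k + 2)
          + Real.sqrt m * R / 2 ^ 10 * ∑ k ∈ Finset.range N, δ k) := by
      rw [Finset.mul_sum (a := Real.sqrt m * R / 2 ^ 10), ← Finset.sum_add_distrib, Finset.mul_sum]
      refine Finset.sum_congr rfl fun k _ => ?_
      simp only [hxdef]
      ring
    have h2 := sum_dyadic_mul_partial_sum (D * R) (fun j => Real.sqrt (H j)) N
    have h3 := sum_dyadic_le (c := D * R) (by positivity) N
    have h4 : 0 ≤ 2 * (D * R / 2 ^ N) * ∑ j ∈ Finset.range (N + 1), Real.sqrt (H j) := by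
      have := hA0 (N + 1)
      positivity
    have h5 : 0 ≤ 2 * (D * R) * Real.sqrt (H 0) := by positivity
    have h6 : ∑ k ∈ Finset.range N, δ k * A (k + 2) ≤ 4 * (Real.sqrt m * R ^ 2 / 2 ^ 11) := by
      have : D * Real.sqrt m * R ^ 2 / 2 ^ 11 ≤ Real.sqrt m * R ^ 2 / 2 ^ 11 := by
        have : D * (Real.sqrt m * R ^ 2) ≤ 1 * (Real.sqrt m * R ^ 2) :=
          mul_le_mul_of_nonneg_right hD1 (by positivity)
        linarith
      simp only [hδdef, hAdef]
      linarith
    have h7 : Real.sqrt m * R / 2 ^ 10 * ∑ k ∈ Finset.range N, δ k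
        ≤ Real.sqrt m * R / 2 ^ 10 * (2 * R) :=
      mul_le_mul_of_nonneg_left (h3.trans (by nlinarith)) (by positivity)
    have h8 : Real.sqrt 8 ≤ 3 := by
      rw [Real.sqrt_le_left (by norm_num)]
      norm_num
    rw [h1]
    calc Real.sqrt 8 * Real.sqrt m * _
        ≤ Real.sqrt 8 * Real.sqrt m * (Real.sqrt m * R ^ 2 / 2 ^ 8) :=
          mul_le_mul_of_nonneg_left (by linarith) (by positivity)
      _ = Real.sqrt 8 * (Real.sqrt m ^ 2 * R ^ 2) / 2 ^ 8 := by ring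
      _ ≤ _ := by
          rw [hsm2]
          have : 0 ≤ m * R ^ 2 := by positivity
          have := mul_le_mul_of_nonneg_right h8 this
          linarith
  have hH00 : H 0 ≤ m * R ^ 2 / 2 ^ 22 := by
    have h1 : D * R / 2 ^ 0 * Real.sqrt (H 0)
        ≤ ∑ j ∈ Finset.range (N + 1), D * R / 2 ^ j * Real.sqrt (H j) :=
      Finset.single_le_sum (f := fun j => D * R / 2 ^ j * Real.sqrt (H j))
        (fun j _ => by positivity) (Finset.mem_range.2 (Nat.succ_pos N))
    have h2 : D * R * Real.sqrt (H 0) ≤ D * R * (Real.sqrt m * R / 2 ^ 11) := by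
      have := h1.trans hS
      rw [pow_zero, div_one] at this
      linarith
    have h3 := pow_le_pow_left₀ (Real.sqrt_nonneg _)
      (le_of_mul_le_mul_left h2 (by positivity)) 2
    rw [Real.sq_sqrt (hH0 0), div_pow, mul_pow, hsm2] at h3
    linarith
  set start : (∀ i, M.obs i → ℝ) → Set M.Data := fun a =>
    {y | ∑ i, (∫ z, M.sqrtRatio θ₀ a i z ∂(M.obsLaw θ₀ i) - 1) + m * R ^ 2 / 64
      ≤ ∑ i, logMaj (M.sqrtRatio θ₀ a i (y i))} with hstart
  set refineEvent : ℕ → (∀ i, M.obs i → ℝ) × (∀ i, M.obs i → ℝ) → Set M.Data := fun k q =>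
    {y | ∑ i, M.refineLoss θ₀ q.1 q.2 i (y i)
      ≤ ∑ i, ∫ z, M.refineLoss θ₀ q.1 q.2 i z ∂(M.obsLaw θ₀ i) - x k} with hrefine
  set S₀ : Finset (∀ i, M.obs i → ℝ) := (chainSet b 0).filter fun a => M.Admissible a
  -- The refinement events do not involve `θ`, which only witnesses that a pair obeys the tail
  -- bound. A union over finitely many pairs thus serves the whole shell.
  set T : ℕ → Finset ((∀ i, M.obs i → ℝ) × (∀ i, M.obs i → ℝ)) := fun k =>
    (chainSet b k ×ˢ Finset.univ.image (b (k + 1))).filter fun q =>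
      ∃ θ, M.UpperApprox θ (δ k) q.1 ∧ M.UpperApprox θ (δ (k + 1)) q.2
  have hmR : 0 ≤ m * R ^ 2 := by positivity
  have hP0 : M.law θ₀ (⋃ a ∈ S₀, start a) ≤ ENNReal.ofReal (Real.exp (-(m * R ^ 2 / 2 ^ 20))) := by
    refine (measure_biUnion_finset_le_card_mul _ S₀ start _ fun a ha =>
      Admissible.start_tail (Finset.mem_filter.1 ha).2 θ₀ _).trans ?_
    rw [← ENNReal.ofReal_natCast, ← ENNReal.ofReal_mul (by positivity)]
    apply ENNReal.ofReal_le_ofReal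
    have h1 : (S₀.card : ℝ) ≤ Real.exp (H 0) := by
      have := card_chainSet_le b hH 0
      simp only [zero_add, Finset.sum_range_one] at this
      exact le_trans (by exact_mod_cast Finset.card_filter_le _ _) this
    refine (mul_le_mul_of_nonneg_right h1 (Real.exp_pos _).le).trans ?_
    rw [← Real.exp_add]
    apply Real.exp_le_exp.2
    linarith
  have hPk : ∀ k, M.law θ₀ (⋃ q ∈ T k, refineEvent k q)
      ≤ ENNReal.ofReal (Real.exp (-(m * R ^ 2 / 2 ^ 20))) := by
    intro k
    refine (measure_biUnion_finset_le_card_mul _ (T k) (refineEvent k) _ fun q hq => by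
      obtain ⟨θ, h1, h2⟩ := (Finset.mem_filter.1 hq).2
      exact h1.refine_tail hm (hδ k) h2 θ₀ (hx0 k)).trans ?_
    rw [← ENNReal.ofReal_natCast, ← ENNReal.ofReal_mul (by positivity)]
    apply ENNReal.ofReal_le_ofReal
    have h1 : ((T k).card : ℝ) ≤ Real.exp (∑ j ∈ Finset.range (k + 2), H j) := by
      have h2 := card_chainSet_le b hH k
      have h3 : ((Finset.univ.image (b (k + 1))).card : ℝ) ≤ Real.exp (H (k + 1)) := by
        refine le_trans ?_ (hH (k + 1))
        have := Finset.card_image_le (s := Finset.univ) (f := b (k + 1))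
        rw [Finset.card_univ, Fintype.card_fin] at this
        exact_mod_cast this
      have h4 : ((T k).card : ℝ)
          ≤ ((chainSet b k).card : ℝ) * ((Finset.univ.image (b (k + 1))).card : ℝ) := by
        rw [← Nat.cast_mul, ← Finset.card_product]
        exact_mod_cast Finset.card_filter_le _ _
      rw [Finset.sum_range_succ, Real.exp_add]
      exact h4.trans (mul_le_mul h2 h3 (by positivity) (Real.exp_pos _).le)
    refine (mul_le_mul_of_nonneg_right h1 (Real.exp_pos _).le).trans ?_
    rw [← Real.exp_add]
    apply Real.exp_le_exp.2
    have := hx2 k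
    linarith
  refine ⟨{y | ¬ ∀ i, 0 < M.p i θ₀ (y i)} ∪
    ((⋃ a ∈ S₀, start a) ∪ ⋃ k ∈ Finset.range N, ⋃ q ∈ T k, refineEvent k q), ?_, ?_⟩
  · refine (measure_union_le _ _).trans ?_
    have h0 : M.law θ₀ {y | ¬ ∀ i, 0 < M.p i θ₀ (y i)} = 0 := ae_law_p_pos θ₀
    rw [h0, zero_add]
    refine (measure_union_le _ _).trans ((add_le_add hP0
      (measure_biUnion_finset_le_card_mul _ (Finset.range N) _ _ fun k _ => hPk k)).trans ?_)
    rw [Finset.card_range, ← ENNReal.ofReal_natCast, ← ENNReal.ofReal_mul (by positivity),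
      ← ENNReal.ofReal_add (Real.exp_pos _).le (by positivity)]
    apply ENNReal.ofReal_le_ofReal
    linarith
  · intro y hy θ hθ1 hθ2
    simp only [Set.mem_union, not_or, Set.mem_iUnion, not_exists, Set.mem_ofPred_eq, not_not] at hy
    obtain ⟨hy0, hy1, hy2⟩ := hy
    choose s hs using fun j => (hb j).upperApprox hm hθ2
    set a : ℕ → ∀ i, M.obs i → ℝ := fun k => Nat.rec (b 0 (s 0))
      (fun k c => fun i y => min (c i y) (b (k + 1) (s (k + 1)) i y)) k with hadef
    have hasucc : ∀ k, a (k + 1) = fun i y => min (a k i y) (b (k + 1) (s (k + 1)) i y) :=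
      fun k => rfl
    have hmem : ∀ k, a k ∈ chainSet b k := by
      intro k
      induction k with
      | zero => exact Finset.mem_image_of_mem _ (Finset.mem_univ _)
      | succ k ih =>
        rw [hasucc]
        exact Finset.mem_image₂_of_mem ih (Finset.mem_image_of_mem _ (Finset.mem_univ _))
    have hua : ∀ k, M.UpperApprox θ (δ k) (a k) := by
      intro k
      induction k with
      | zero => exact hs 0
      | succ k ih =>
        rw [hasucc]
        exact ih.inf (hs (k + 1))
    -- Each refinement falls short of its mean loss by less than `x k`, so the running sum follows
    -- the mean at its own level, with accumulated error.
    have hmain : ∀ k ≤ N, ∑ i, logMaj (M.sqrtRatio θ₀ (a k) i (y i))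
        ≤ ∑ i, ∫ z, logMaj (M.sqrtRatio θ₀ (a k) i z) ∂(M.obsLaw θ₀ i)
          + (m * (2 * δ 0 ^ 2 + 2 * M.hell θ θ₀ ^ 2) / 63 + m * R ^ 2 / 64)
          + ∑ j ∈ Finset.range k, x j := by
      intro k
      induction k with
      | zero =>
        intro _
        have h1 := hy1 (a 0) (Finset.mem_filter.2 ⟨hmem 0, (hua 0).toAdmissible⟩)
        simp only [hstart, Set.mem_ofPred_eq, not_le] at h1
        have h2 := (hua 0).sum_integral_sub_one_le hm θ₀
        simp only [Finset.range_zero, Finset.sum_empty]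
        linarith
      | succ k ih =>
        intro hk
        have h0 := ih (by omega)
        have h1 := hy2 k (Finset.mem_range.2 (by omega)) (a k, b (k + 1) (s (k + 1)))
          (Finset.mem_filter.2 ⟨Finset.mem_product.2 ⟨hmem k,
            Finset.mem_image_of_mem _ (Finset.mem_univ _)⟩, θ, hua k, hs (k + 1)⟩)
        simp only [hrefine, Set.mem_ofPred_eq, not_le] at h1
        have h2 : ∀ i, ∫ z, M.refineLoss θ₀ (a k) (b (k + 1) (s (k + 1))) i z ∂(M.obsLaw θ₀ i)
            = ∫ z, logMaj (M.sqrtRatio θ₀ (a k) i z) ∂(M.obsLaw θ₀ i)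
              - ∫ z, logMaj (M.sqrtRatio θ₀ (a (k + 1)) i z) ∂(M.obsLaw θ₀ i) := fun i =>
          integral_sub ((hua k).integrable_logMaj θ₀ i) ((hua (k + 1)).integrable_logMaj θ₀ i)
        have h3 : ∑ i, M.refineLoss θ₀ (a k) (b (k + 1) (s (k + 1))) i (y i)
            = ∑ i, logMaj (M.sqrtRatio θ₀ (a k) i (y i))
              - ∑ i, logMaj (M.sqrtRatio θ₀ (a (k + 1)) i (y i)) := by
          rw [← Finset.sum_sub_distrib]
          rfl
        simp only [h2, Finset.sum_sub_distrib] at h1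
        rw [h3] at h1
        rw [Finset.sum_range_succ]
        linarith
    have h1 := hmain N le_rfl
    have h2 := (hua N).sum_integral_logMaj_le hm (hδ N) θ₀
    -- In units of `m R²`: `-1/8 + 1/2^9` from the mean, `4/63 + 1/64` from the start, `3/2^8` from
    -- the refinements; the total is below `-1/64`.
    have hfin : ∑ i, logMaj (M.sqrtRatio θ₀ (a N) i (y i)) ≤ -(m * R ^ 2 / 64) := by
      have h3 : δ 0 ^ 2 ≤ R ^ 2 := by
        rw [hδ0]
        exact pow_le_pow_left₀ (by positivity) (by nlinarith) 2
      have h4 : M.hell θ θ₀ ^ 2 ≤ R ^ 2 := pow_le_pow_left₀ (by linarith) hθ2 2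
      have h5 : (R / 2) ^ 2 ≤ M.hell θ θ₀ ^ 2 := pow_le_pow_left₀ (by positivity) hθ1 2
      have h6 : m * (2 * δ 0 ^ 2 + 2 * M.hell θ θ₀ ^ 2) ≤ m * (4 * R ^ 2) :=
        mul_le_mul_of_nonneg_left (by linarith) hm'.le
      have h7 : m * (-(M.hell θ θ₀ ^ 2 / 2) + 2 * δ N) ≤ m * (-(R ^ 2 / 8) + R ^ 2 / 2 ^ 9) :=
        mul_le_mul_of_nonneg_left (by linarith) hm'.le
      linarith
    have h3 := (hua N).likelihood_le hy0 hfin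
    refine h3.trans (le_of_eq ?_)
    congr 2
    ring

end SubsetModel

/-! ### From the entropy condition to a bound outside a Hellinger ball. -/

/-- A dyadic entropy sum is dominated by the entropy integral. -/
theorem dyadic_sum_le_integral {f : ℝ → ℝ} (hf : AntitoneOn f (Set.Ioi 0)) {c : ℝ} (hc : 0 < c)
    (n : ℕ) :
    ∑ j ∈ Finset.range n, c / 2 ^ j * f (c / 2 ^ j) ≤ 2 * ∫ u in (c / 2 ^ n)..c, f u := by
  have hpos : ∀ n : ℕ, 0 < c / 2 ^ n := fun n => by positivity
  have hii : ∀ a b, 0 < a → 0 < b → IntervalIntegrable f volume a b := fun a b ha hb =>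
    (hf.mono fun z hz => lt_of_lt_of_le (lt_min ha hb) hz.1).intervalIntegrable
  induction n with
  | zero => simp
  | succ n ih =>
    have hlt : c / 2 ^ (n + 1) ≤ c / 2 ^ n := by
      rw [pow_succ, ← div_div]
      linarith [hpos n]
    have h1 := intervalIntegral.integral_add_adjacent_intervals
      (hii _ _ (hpos (n + 1)) (hpos n)) (hii _ _ (hpos n) hc)
    have h2 : (c / 2 ^ n - c / 2 ^ (n + 1)) * f (c / 2 ^ n)
        ≤ ∫ u in (c / 2 ^ (n + 1))..(c / 2 ^ n), f u := by
      have h3 := intervalIntegral.integral_mono_on hlt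
        (intervalIntegrable_const (μ := volume) (c := f (c / 2 ^ n)))
        (hii _ _ (hpos (n + 1)) (hpos n)) fun z hz =>
          hf (lt_of_lt_of_le (hpos (n + 1)) hz.1) (hpos n) hz.2
      rwa [intervalIntegral.integral_const, smul_eq_mul] at h3
    have h4 : c / 2 ^ n - c / 2 ^ (n + 1) = c / 2 ^ n / 2 := by
      rw [pow_succ, ← div_div]; ring
    rw [h4] at h2
    rw [Finset.sum_range_succ]
    linarith

namespace SubsetModel

variable {Θ : Type u} [MeasurableSpace Θ] {m : ℕ} {M : SubsetModel.{u, v} Θ m}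

/-- The `1 +` inside the entropy puts the infimum strictly below `exp h`, hence some actual
bracketing set is below it too. -/
theorem exists_isBracketing_of_bracketingEntropy_le {Ξ : Set Θ} {δ h : ℝ}
    (hle : M.bracketingEntropy Ξ δ ≤ (h : EReal)) :
    ∃ (N : ℕ) (l u : Fin N → ∀ i, M.obs i → ℝ),
      (N : ℝ) ≤ Real.exp h ∧ M.IsBracketing Ξ δ l u := by
  have h1 := EReal.exp_monotone hle
  rw [bracketingEntropy, ENNReal.exp_log, EReal.exp_coe] at h1
  have hne : M.bracketingNumber Ξ δ ≠ ∞ := by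
    intro h2
    rw [h2, add_top, top_le_iff] at h1
    exact ENNReal.ofReal_ne_top h1
  have h2 : M.bracketingNumber Ξ δ < ENNReal.ofReal (Real.exp h) := by
    refine lt_of_lt_of_le ?_ h1
    rw [add_comm]
    exact ENNReal.lt_add_right hne one_ne_zero
  unfold bracketingNumber at h2
  simp only [iInf_lt_iff] at h2
  obtain ⟨N, ⟨l, u, hlu⟩, hN⟩ := h2
  refine ⟨N, l, u, ?_, hlu⟩
  rw [← ENNReal.ofReal_natCast] at hN
  exact ((ENNReal.ofReal_lt_ofReal_iff (Real.exp_pos h)).1 hN).le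

theorem exists_shell_exceptional_set_of_entropy (hm : 0 < m) (θ₀ : Θ) {R D₁ D₂ : ℝ} (hR : 0 < R)
    (hR2 : R ≤ 2 ^ 11) (hD : 0 < D₁) (hD1 : D₁ ≤ 1) (hD2 : D₂ < D₁ ^ 2 / 2 ^ 12) {ψ : ℝ → ℝ}
    (hψ0 : ∀ u > 0, 0 ≤ ψ u) (hψ : AntitoneOn ψ (Set.Ioi 0))
    (hent : ∀ u > 0, M.bracketingEntropy {θ | M.hell θ θ₀ ≤ R} u ≤ ((ψ u : ℝ) : EReal))
    (hintg : ∫ u in (D₁ * R ^ 2 / 2 ^ 12)..(D₁ * R), Real.sqrt (ψ u) < D₂ * Real.sqrt m * R ^ 2) :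
    ∃ Bad : Set M.Data,
      M.law θ₀ Bad ≤ ENNReal.ofReal (2 ^ 11 / R * Real.exp (-(m * R ^ 2 / 2 ^ 20))) ∧
      ∀ y ∉ Bad, ∀ θ, R / 2 ≤ M.hell θ θ₀ → M.hell θ θ₀ ≤ R →
        M.likelihood y θ ≤ Real.exp (-(m * R ^ 2 / 32)) * M.likelihood y θ₀ := by
  -- `2^N ≤ 2^11/R < 2^(N+1)`: the first inequality keeps the dyadic scales above the lower limit of
  -- the integral and bounds `N + 1` by `2^11/R`; the second makes the finest bracket error at most
  -- `R²/2^10`.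
  obtain ⟨N, hN1, hN2⟩ := exists_nat_pow_near (x := 2 ^ 11 / R) (y := 2)
    ((one_le_div hR).2 hR2) one_lt_two
  have hpos : ∀ j : ℕ, 0 < D₁ * R / 2 ^ j := fun j => by positivity
  have hanti : AntitoneOn (fun u => Real.sqrt (ψ u)) (Set.Ioi 0) := fun a ha b hb hab =>
    Real.sqrt_le_sqrt (hψ ha hb hab)
  have h2N : (0 : ℝ) < 2 ^ N := by positivity
  rw [le_div_iff₀ hR] at hN1
  rw [div_lt_iff₀ hR, pow_succ (2 : ℝ) N] at hN2
  choose Nb l b hNb hlb using fun j : ℕ =>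
    exists_isBracketing_of_bracketingEntropy_le (hent (D₁ * R / 2 ^ j) (hpos j))
  have hS : ∑ j ∈ Finset.range (N + 1), D₁ * R / 2 ^ j * Real.sqrt (ψ (D₁ * R / 2 ^ j))
      ≤ D₁ * Real.sqrt m * R ^ 2 / 2 ^ 11 := by
    have h1 := dyadic_sum_le_integral hanti (c := D₁ * R) (by positivity) (N + 1)
    have hle : D₁ * R ^ 2 / 2 ^ 12 ≤ D₁ * R / 2 ^ (N + 1) := by
      rw [div_le_div_iff₀ (by positivity) (by positivity), pow_succ (2 : ℝ) N]
      have := mul_le_mul_of_nonneg_left hN1 (by positivity : 0 ≤ D₁ * R)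
      nlinarith
    have hp : 0 < D₁ * R ^ 2 / 2 ^ 12 := by positivity
    have hii : ∀ a b, 0 < a → 0 < b →
        IntervalIntegrable (fun u => Real.sqrt (ψ u)) volume a b := fun a b ha hb =>
      (hanti.mono fun z hz => lt_of_lt_of_le (lt_min ha hb) hz.1).intervalIntegrable
    have h2 := intervalIntegral.integral_add_adjacent_intervals
      (hii _ _ hp (hpos (N + 1))) (hii _ (D₁ * R) (hpos (N + 1)) (by positivity))
    have h3 : 0 ≤ ∫ u in (D₁ * R ^ 2 / 2 ^ 12)..(D₁ * R / 2 ^ (N + 1)), Real.sqrt (ψ u) :=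
      intervalIntegral.integral_nonneg hle fun u _ => Real.sqrt_nonneg _
    have h4 : D₂ * (Real.sqrt m * R ^ 2) ≤ D₁ ^ 2 / 2 ^ 12 * (Real.sqrt m * R ^ 2) :=
      mul_le_mul_of_nonneg_right hD2.le (by positivity)
    have h5 : D₁ ^ 2 * (Real.sqrt m * R ^ 2) ≤ D₁ * (Real.sqrt m * R ^ 2) :=
      mul_le_mul_of_nonneg_right (by nlinarith) (by positivity)
    linarith
  obtain ⟨Bad, hB1, hB2⟩ := exists_shell_exceptional_set hm θ₀ hR hD hD1 N
    (fun j => ψ (D₁ * R / 2 ^ j)) (fun j => hψ0 _ (hpos j)) hNb l b hlb hS (by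
      rw [div_le_div_iff₀ h2N (by norm_num)]
      have h1 : D₁ * R * 2 ^ 10 ≤ R * 2 ^ 10 := by
        have := mul_le_mul_of_nonneg_right hD1 (by positivity : 0 ≤ R * 2 ^ 10)
        linarith
      nlinarith)
  refine ⟨Bad, hB1.trans (ENNReal.ofReal_le_ofReal ?_), hB2⟩
  refine mul_le_mul_of_nonneg_right ?_ (Real.exp_pos _).le
  rw [le_div_iff₀ hR]
  refine le_trans (mul_le_mul_of_nonneg_right ?_ hR.le) hN1
  exact_mod_cast Nat.lt_two_pow_self (n := N)

/-- Outside of a Hellinger ball the likelihood ratio is uniformly small. -/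
theorem exists_exceptional_set (hm : 0 < m) (θ₀ : Θ) {r D₁ D₂ : ℝ} (hr : 0 < r)
    (hD : 0 < D₁) (hD1 : D₁ ≤ 1) (hD2 : D₂ < D₁ ^ 2 / 2 ^ 12) {Ψ : ℝ → ℝ → ℝ}
    (hΨ0 : ∀ u > 0, ∀ r > 0, 0 ≤ Ψ u r) (hΨ : ∀ r > 0, AntitoneOn (fun u => Ψ u r) (Set.Ioi 0))
    (hent : ∀ R ≥ r, (∀ u > 0,
        M.bracketingEntropy {θ | M.hell θ θ₀ ≤ R} u ≤ ((Ψ u R : ℝ) : EReal)) ∧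
      ∫ u in (D₁ * R ^ 2 / 2 ^ 12)..(D₁ * R), Real.sqrt (Ψ u R) < D₂ * Real.sqrt m * R ^ 2) :
    ∃ Bad : Set M.Data,
      M.law θ₀ Bad ≤ ENNReal.ofReal (2 ^ 11 / r * Real.exp (-(m * r ^ 2 / 2 ^ 20))) ∧
      ∀ y ∉ Bad, ∀ θ, r ≤ M.hell θ θ₀ →
        M.likelihood y θ ≤ Real.exp (-(m * r ^ 2 / 32)) * M.likelihood y θ₀ := by
  have hlik : ∀ y, 0 ≤ M.likelihood y θ₀ := fun y =>
    Finset.prod_nonneg fun i _ => M.p_nonneg i θ₀ _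
  have hm' : (0 : ℝ) < m := by exact_mod_cast hm
  have hRr : ∀ k : ℕ, r ≤ 2 ^ (k + 1) * r := fun k => by
    have : (1 : ℝ) ≤ 2 ^ (k + 1) := one_le_pow₀ one_le_two
    nlinarith
  have hexp : ∀ (k : ℕ) (c : ℝ), 0 < c → Real.exp (-(m * (2 ^ (k + 1) * r) ^ 2 / c))
      ≤ Real.exp (-(m * r ^ 2 / c)) := fun k c hc => by
    apply Real.exp_le_exp.2
    have h1 := mul_le_mul_of_nonneg_left (pow_le_pow_left₀ hr.le (hRr k) 2) hm'.le
    have h2 := div_le_div_of_nonneg_right h1 hc.le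
    linarith
  have hshell : ∀ k : ℕ, ∃ Bad : Set M.Data,
      M.law θ₀ Bad ≤ ENNReal.ofReal
        (2 ^ 11 / (2 ^ (k + 1) * r) * Real.exp (-(m * (2 ^ (k + 1) * r) ^ 2 / 2 ^ 20))) ∧
      ∀ y ∉ Bad, ∀ θ, 2 ^ (k + 1) * r / 2 ≤ M.hell θ θ₀ → M.hell θ θ₀ ≤ 2 ^ (k + 1) * r →
        M.likelihood y θ ≤ Real.exp (-(m * (2 ^ (k + 1) * r) ^ 2 / 32)) * M.likelihood y θ₀ := by
    intro k
    have hR : 0 < 2 ^ (k + 1) * r := by positivity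
    by_cases hk : 2 ^ (k + 1) * r ≤ 2 ^ 11
    · obtain ⟨h1, h2⟩ := hent _ (hRr k)
      exact exists_shell_exceptional_set_of_entropy hm θ₀ hR hk hD hD1 hD2
        (fun u hu => hΨ0 u hu _ hR) (hΨ _ hR) h1 h2
    -- Hellinger distances are at most `√2`, so this shell is empty.
    · refine ⟨∅, by simp, fun y _ θ h1 _ => ?_⟩
      have h2 := hell_sq_le_two hm θ θ₀ (M := M)
      push Not at hk
      nlinarith
  choose Bad hB1 hB2 using hshell
  refine ⟨⋃ k, Bad k, ?_, ?_⟩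
  -- The prefactor `2^11 / (2^(k+1) r)` is already geometric in `k`; the exponentials are only
  -- compared with the first radius.
  · set c := 2 ^ 11 / r * Real.exp (-(m * r ^ 2 / 2 ^ 20)) with hc
    have hc0 : 0 ≤ c := by positivity
    have hsum := hasSum_geometric_two' c
    calc M.law θ₀ (⋃ k, Bad k) ≤ ∑' k, M.law θ₀ (Bad k) := measure_iUnion_le _
      _ ≤ ∑' k : ℕ, ENNReal.ofReal (c / 2 / 2 ^ k) := by
          refine ENNReal.tsum_le_tsum fun k => (hB1 k).trans (ENNReal.ofReal_le_ofReal ?_)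
          have h1 : 2 ^ 11 / (2 ^ (k + 1) * r) * Real.exp (-(m * r ^ 2 / 2 ^ 20)) = c / 2 / 2 ^ k := by
            rw [hc, pow_succ (2 : ℝ) k]
            field_simp
          rw [← h1]
          exact mul_le_mul_of_nonneg_left (hexp k _ (by norm_num)) (by positivity)
      _ = ENNReal.ofReal c := by
          rw [← ENNReal.ofReal_tsum_of_nonneg (fun k => by positivity) hsum.summable, hsum.tsum_eq]
  · intro y hy θ hθ
    simp only [Set.mem_iUnion, not_exists] at hy
    obtain ⟨k, hk1, hk2⟩ := exists_nat_pow_near (x := M.hell θ θ₀ / r) (y := 2)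
      ((one_le_div hr).2 hθ) one_lt_two
    rw [le_div_iff₀ hr] at hk1
    rw [div_lt_iff₀ hr] at hk2
    refine (hB2 k y (hy k) θ (by rw [pow_succ]; linarith) hk2.le).trans ?_
    exact mul_le_mul_of_nonneg_right (hexp k 32 (by norm_num)) (hlik y)

/-- The likelihood is bounded in the parameter, since finitely many brackets cover. -/
theorem exists_likelihood_le (hm : 0 < m) {θ₀ : Θ} {R h δ : ℝ} (hR : 2 ≤ R ^ 2) (hR0 : 0 ≤ R)
    (hle : M.bracketingEntropy {θ | M.hell θ θ₀ ≤ R} δ ≤ (h : EReal)) (y : M.Data) :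
    ∃ B : ℝ, ∀ θ, M.likelihood y θ ≤ B := by
  obtain ⟨N, l, u, -, hN⟩ := exists_isBracketing_of_bracketingEntropy_le hle
  refine ⟨∑ s, ∏ i, u s i (y i), fun θ => ?_⟩
  obtain ⟨s, hs⟩ := hN.2.2 θ (by
    have := hell_sq_le_two hm θ θ₀ (M := M)
    exact (sq_le_sq₀ (Real.sqrt_nonneg _) hR0).1 (this.trans hR))
  have h0 : ∀ s i, 0 ≤ u s i (y i) := fun s i =>
    ((hN.1 s i).2.2 (y i)).1.trans ((hN.1 s i).2.2 (y i)).2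
  calc M.likelihood y θ ≤ ∏ i, u s i (y i) :=
        Finset.prod_le_prod (fun i _ => M.p_nonneg i θ _) fun i _ => (hs i (y i)).2
    _ ≤ _ := Finset.single_le_sum (f := fun s => ∏ i, u s i (y i))
        (fun s _ => Finset.prod_nonneg fun i _ => h0 s i) (Finset.mem_univ s)

end SubsetModel

/-! ### Lower bound for the evidence, and posterior moments. -/

/-- A product bound from a bound of the product of truncated ratios. -/
theorem prod_le_of_prod_max_one_div_rpow_lt {ι : Type*} [Fintype ι] {a b : ι → ℝ}
    (ha : ∀ i, 0 ≤ a i) (hb : ∀ i, 0 ≤ b i) {κ C : ℝ} (hκ : 0 < κ) (hC : 0 < C)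
    (h : ∏ i, (max 1 (ENNReal.ofReal (a i) / ENNReal.ofReal (b i))) ^ κ < ENNReal.ofReal C) :
    ∏ i, a i ≤ C ^ (1 / κ) * ∏ i, b i := by
  set V : ι → ℝ≥0∞ := fun i => max 1 (ENNReal.ofReal (a i) / ENNReal.ofReal (b i)) with hV
  rw [ENNReal.prod_rpow_of_nonneg hκ.le] at h
  have hV1 : ∀ i, 1 ≤ V i := fun i => le_max_left _ _
  have hle : ∏ i, V i ≤ ENNReal.ofReal (C ^ (1 / κ)) := by
    have h1 := ENNReal.rpow_le_rpow h.le (one_div_nonneg.2 hκ.le)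
    rwa [← ENNReal.rpow_mul, mul_one_div_cancel hκ.ne', ENNReal.rpow_one,
      ENNReal.ofReal_rpow_of_pos hC] at h1
  -- As all factors are at least `1`, a finite product bounds each of them; this excludes `b i = 0 <
  -- a i`.
  have hVt : ∀ i, V i ≠ ∞ := fun i => ne_top_of_le_ne_top ENNReal.ofReal_ne_top
    ((Finset.single_le_prod' (fun j _ => hV1 j) (Finset.mem_univ i)).trans hle)
  have hi : ∀ i, ENNReal.ofReal (a i) ≤ V i * ENNReal.ofReal (b i) := fun i =>
    (ENNReal.div_le_iff_le_mul (Or.inr (hVt i)) (Or.inl ENNReal.ofReal_ne_top)).1 (le_max_right _ _)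
  have h2 : ENNReal.ofReal (∏ i, a i) ≤ ENNReal.ofReal (C ^ (1 / κ) * ∏ i, b i) := by
    rw [ENNReal.ofReal_prod_of_nonneg fun i _ => ha i, ENNReal.ofReal_mul (by positivity),
      ENNReal.ofReal_prod_of_nonneg fun i _ => hb i]
    refine (Finset.prod_le_prod' fun i _ => hi i).trans ?_
    rw [Finset.prod_mul_distrib]
    gcongr
  exact (ENNReal.ofReal_le_ofReal_iff
    (mul_nonneg (by positivity) (Finset.prod_nonneg fun i _ => hb i))).1 h2

/-- Factorwise `e ≤ exp(e - 1)`, and the `e i - 1` sum to at most `c`. -/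
theorem prod_le_exp_of_mean_le {m : ℕ} (hm : 0 < m) (e : Fin m → ℝ≥0∞) {c : ℝ} (hc : 0 ≤ c)
    (h : (m : ℝ≥0∞)⁻¹ * ∑ i, e i ≤ 1 + ENNReal.ofReal (c / m)) :
    ∏ i, e i ≤ ENNReal.ofReal (Real.exp c) := by
  have hm0 : (m : ℝ≥0∞) ≠ 0 := by exact_mod_cast hm.ne'
  have hm' : (0 : ℝ) < m := by exact_mod_cast hm
  have h1 : ∑ i, e i ≤ ENNReal.ofReal (m + c) := by
    have h2 := mul_le_mul_right h (m : ℝ≥0∞)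
    rw [← mul_assoc, ENNReal.mul_inv_cancel hm0 (ENNReal.natCast_ne_top m), one_mul] at h2
    refine h2.trans (le_of_eq ?_)
    rw [← ENNReal.ofReal_one, ← ENNReal.ofReal_add zero_le_one (by positivity),
      ← ENNReal.ofReal_natCast, ← ENNReal.ofReal_mul hm'.le]
    congr 1
    field_simp
  have hfin : ∀ i, e i ≠ ∞ := fun i => ne_top_of_le_ne_top ENNReal.ofReal_ne_top
    ((Finset.single_le_sum (f := e) (fun _ _ => zero_le) (Finset.mem_univ i)).trans h1)
  have h3 : ∑ i, (e i).toReal ≤ m + c := by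
    rw [← ENNReal.toReal_sum fun i _ => hfin i]
    exact ENNReal.toReal_le_of_le_ofReal (by positivity) h1
  have h4 : ∀ i, e i ≤ ENNReal.ofReal (Real.exp ((e i).toReal - 1)) := fun i => by
    nth_rewrite 1 [← ENNReal.ofReal_toReal (hfin i)]
    apply ENNReal.ofReal_le_ofReal
    have := Real.add_one_le_exp ((e i).toReal - 1)
    linarith
  refine (Finset.prod_le_prod' fun i _ => h4 i).trans ?_
  rw [← ENNReal.ofReal_prod_of_nonneg fun i _ => (Real.exp_pos _).le, ← Real.exp_sum]
  apply ENNReal.ofReal_le_ofReal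
  apply Real.exp_le_exp.2
  rw [Finset.sum_sub_distrib]
  simp only [Finset.sum_const, Finset.card_univ, Fintype.card_fin, nsmul_eq_mul, mul_one]
  linarith

namespace SubsetModel

variable {Θ : Type u} [MeasurableSpace Θ] {m : ℕ} {M : SubsetModel.{u, v} Θ m}

theorem likelihood_nonneg (y : M.Data) (θ : Θ) : 0 ≤ M.likelihood y θ :=
  Finset.prod_nonneg fun i _ => M.p_nonneg i θ _

theorem measurable_likelihood (y : M.Data) : Measurable (M.likelihood y) := by
  unfold likelihood
  exact Finset.measurable_prod _ fun i _ => (M.p_measurable i).comp measurable_prodMk_right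

theorem measurable_likelihood_rpow (y : M.Data) (γ : ℝ) :
    Measurable fun θ => ENNReal.ofReal (M.likelihood y θ ^ γ) :=
  ((measurable_likelihood y).pow_const γ).ennreal_ofReal

/-- The integrand of `expLogRatio`, as a function of the parameter and the observation. -/
def ratioPow (M : SubsetModel.{u, v} Θ m) (κ : ℝ) (θ₀ : Θ) (i : Fin m) (z : Θ × M.obs i) : ℝ≥0∞ :=
  (max 1 (ENNReal.ofReal (M.p i θ₀ z.2) / ENNReal.ofReal (M.p i z.1 z.2))) ^ κ

theorem measurable_ratioPow (κ : ℝ) (θ₀ : Θ) (i : Fin m) : Measurable (M.ratioPow κ θ₀ i) :=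
  (measurable_const.max ((((M.measurable_p i θ₀).comp measurable_snd).ennreal_ofReal).div
    (M.p_measurable i).ennreal_ofReal)).pow_const κ

/-- With high probability the evidence is not much smaller than the prior mass of a neighborhood of
`θ₀` times the likelihood of `θ₀`. -/
theorem exists_evidence_exceptional_set (hm : 0 < m) (prior : Measure Θ) [IsProbabilityMeasure prior]
    (θ₀ : Θ) {κ c π₀ T : ℝ} (hκ : 0 < κ) (hc : 0 ≤ c) (hπ₀ : 0 < π₀) (hT : 0 < T)
    (hprior : ENNReal.ofReal π₀
      ≤ prior {θ | M.expLogRatio κ θ₀ θ ≤ 1 + ENNReal.ofReal (c / m)}) :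
    ∃ Bad : Set M.Data, M.law θ₀ Bad ≤ ENNReal.ofReal (Real.exp c / T) ∧
      ∀ y ∉ Bad, ∀ γ > 0,
        ENNReal.ofReal (π₀ / 2 * (M.likelihood y θ₀ / (2 * T) ^ (1 / κ)) ^ γ)
          ≤ M.evidence prior γ y := by
  set B : Set Θ := {θ | M.expLogRatio κ θ₀ θ ≤ 1 + ENNReal.ofReal (c / m)} with hB
  set Z : M.Data → Θ → ℝ≥0∞ := fun y θ => ∏ i, M.ratioPow κ θ₀ i (θ, y i) with hZ
  have hproj : ∀ i, Measurable fun z : M.Data × Θ => (z.2, z.1 i) := fun i =>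
    measurable_snd.prodMk ((measurable_pi_apply i).comp measurable_fst)
  have hZm : Measurable (Function.uncurry Z) :=
    Finset.measurable_prod Finset.univ fun i _ => (measurable_ratioPow κ θ₀ i).comp (hproj i)
  have hZθ : ∀ θ ∈ B, ∫⁻ y, Z y θ ∂(M.law θ₀) ≤ ENNReal.ofReal (Real.exp c) := by
    intro θ hθ
    refine le_trans (le_of_eq ?_) (prod_le_exp_of_mean_le hm _ hc hθ)
    exact lintegral_pi_prod_eq_prod (M.obsLaw θ₀) (fun i y => M.ratioPow κ θ₀ i (θ, y))
      fun i => (measurable_ratioPow κ θ₀ i).comp measurable_prodMk_left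
  have hpB0 : prior B ≠ 0 := (lt_of_lt_of_le (ENNReal.ofReal_pos.2 hπ₀) hprior).ne'
  have hpBt : prior B ≠ ∞ := measure_ne_top _ _
  have hT0 : ENNReal.ofReal T ≠ 0 := by simpa using hT
  have hgm : Measurable fun y => ∫⁻ θ in B, Z y θ ∂prior :=
    Measurable.lintegral_prod_right (f := Z) hZm
  have hintg : ∫⁻ y, ∫⁻ θ in B, Z y θ ∂prior ∂(M.law θ₀) ≤ ENNReal.ofReal (Real.exp c) * prior B := by
    rw [lintegral_lintegral_swap hZm.aemeasurable]
    refine (setLIntegral_mono measurable_const hZθ).trans (le_of_eq ?_)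
    rw [setLIntegral_const]
  -- Markov in the data, after Fubini, for the prior integral of `Z` over `B`.
  refine ⟨{y | ENNReal.ofReal T * prior B ≤ ∫⁻ θ in B, Z y θ ∂prior}, ?_, ?_⟩
  · refine (meas_ge_le_lintegral_div hgm.aemeasurable (mul_ne_zero hT0 hpB0)
      (ENNReal.mul_ne_top ENNReal.ofReal_ne_top hpBt)).trans
      ((ENNReal.div_le_div_right hintg _).trans (le_of_eq ?_))
    rw [ENNReal.mul_div_mul_right _ _ hpB0 hpBt, ENNReal.ofReal_div_of_pos hT]
  · intro y hy γ hγ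
    simp only [Set.mem_ofPred_eq, not_le] at hy
    set L := M.likelihood y θ₀
    have hZy : Measurable (Z y) := hZm.of_uncurry_left
    have hCpos : 0 < (2 * T) ^ (1 / κ) := by positivity
    set G : Set Θ := B ∩ {θ | Z y θ < ENNReal.ofReal (2 * T)} with hG
    set G' : Set Θ := B ∩ {θ | ENNReal.ofReal (2 * T) ≤ Z y θ} with hG'
    -- Markov again, now in `θ` for fixed data: at least half the prior mass of `B` has `Z < 2 T`,
    -- and there the likelihood is comparable with that of `θ₀`.
    have h1 : prior G' ≤ prior B / 2 := by
      have h2 := mul_meas_ge_le_lintegral (μ := prior.restrict B) hZy (ENNReal.ofReal (2 * T))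
      rw [Measure.restrict_apply (measurableSet_le measurable_const hZy)] at h2
      rw [show {θ | ENNReal.ofReal (2 * T) ≤ Z y θ} ∩ B = G' from Set.inter_comm _ _] at h2
      have h3 := h2.trans hy.le
      rw [ENNReal.ofReal_mul zero_le_two, mul_comm (ENNReal.ofReal 2), mul_assoc,
        ENNReal.mul_le_mul_iff_right hT0 ENNReal.ofReal_ne_top] at h3
      rw [ENNReal.le_div_iff_mul_le (Or.inl two_ne_zero) (Or.inl ENNReal.ofNat_ne_top), mul_comm]
      simpa using h3
    have h4 : prior B / 2 ≤ prior G := by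
      have h5 : prior B ≤ prior G + prior G' := by
        refine (measure_mono fun θ hθ => ?_).trans (measure_union_le G G')
        rcases lt_or_ge (Z y θ) (ENNReal.ofReal (2 * T)) with h | h
        · exact Or.inl ⟨hθ, h⟩
        · exact Or.inr ⟨hθ, h⟩
      have h6 := h5.trans (add_le_add_right h1 _)
      have h7 : prior B / 2 ≠ ∞ := ENNReal.div_ne_top hpBt two_ne_zero
      rw [← ENNReal.add_halves (prior B)] at h6
      exact (ENNReal.add_le_add_iff_right h7).1 (by simpa [ENNReal.add_halves] using h6)
    have h8 : ∀ θ ∈ G, ENNReal.ofReal ((L / (2 * T) ^ (1 / κ)) ^ γ)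
        ≤ ENNReal.ofReal (M.likelihood y θ ^ γ) := fun θ hθ => by
      have h9 := prod_le_of_prod_max_one_div_rpow_lt (fun i => M.p_nonneg i θ₀ (y i))
        (fun i => M.p_nonneg i θ (y i)) hκ (by positivity : 0 < 2 * T) hθ.2
      refine ENNReal.ofReal_le_ofReal (Real.rpow_le_rpow
        (div_nonneg (likelihood_nonneg y θ₀) hCpos.le) ?_ hγ.le)
      rw [div_le_iff₀' hCpos]
      exact h9
    calc ENNReal.ofReal (π₀ / 2 * (L / (2 * T) ^ (1 / κ)) ^ γ)
        = ENNReal.ofReal ((L / (2 * T) ^ (1 / κ)) ^ γ) * (ENNReal.ofReal π₀ / 2) := by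
          rw [mul_comm, ENNReal.ofReal_mul (Real.rpow_nonneg
            (div_nonneg (likelihood_nonneg y θ₀) hCpos.le) _), ENNReal.ofReal_div_of_pos two_pos,
            ENNReal.ofReal_ofNat]
      _ ≤ ENNReal.ofReal ((L / (2 * T) ^ (1 / κ)) ^ γ) * prior G := by
          gcongr
          exact (ENNReal.div_le_div_right hprior 2).trans h4
      _ = ∫⁻ θ in G, ENNReal.ofReal ((L / (2 * T) ^ (1 / κ)) ^ γ) ∂prior := by
          rw [setLIntegral_const]
      _ ≤ ∫⁻ θ in G, ENNReal.ofReal (M.likelihood y θ ^ γ) ∂prior :=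
          setLIntegral_mono (measurable_likelihood_rpow y γ) h8
      _ ≤ M.evidence prior γ y := setLIntegral_le_lintegral _ _

theorem isProbabilityMeasure_posterior (prior : Measure Θ) [IsProbabilityMeasure prior] (γ : ℝ)
    (y : M.Data) : IsProbabilityMeasure (M.posterior prior γ y) := by
  unfold posterior
  split_ifs with h
  · refine ⟨?_⟩
    rw [Measure.smul_apply, withDensity_apply _ MeasurableSet.univ, Measure.restrict_univ, smul_eq_mul]
    exact ENNReal.inv_mul_cancel h.1 h.2
  · infer_instance

/-- A posterior moment is at most `a + b` if the integrand is at most `a` up to parameters whose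
contribution, relative to the evidence, is at most `b`. -/
theorem lintegral_posterior_le {prior : Measure Θ} [IsProbabilityMeasure prior] {γ : ℝ} {y : M.Data}
    {g : Θ → ℝ≥0∞} (hg : Measurable g) {a b c : ℝ} (hb : 0 ≤ b) (hc : 0 < c)
    (hev : ENNReal.ofReal c ≤ M.evidence prior γ y) (hev' : M.evidence prior γ y ≠ ∞)
    (h : ∀ θ, g θ ≤ ENNReal.ofReal a ∨
      g θ * ENNReal.ofReal (M.likelihood y θ ^ γ) ≤ ENNReal.ofReal (b * c)) :
    ∫⁻ θ, g θ ∂(M.posterior prior γ y) ≤ ENNReal.ofReal a + ENNReal.ofReal b := by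
  have hev0 : M.evidence prior γ y ≠ 0 := (lt_of_lt_of_le (ENNReal.ofReal_pos.2 hc) hev).ne'
  have hL := measurable_likelihood_rpow y γ
  rw [posterior, if_pos ⟨hev0, hev'⟩, lintegral_smul_measure,
    lintegral_withDensity_eq_lintegral_mul _ hL hg, smul_eq_mul]
  have h1 : ∫⁻ θ, ((fun θ => ENNReal.ofReal (M.likelihood y θ ^ γ)) * g) θ ∂prior
      ≤ ENNReal.ofReal a * M.evidence prior γ y + ENNReal.ofReal b * M.evidence prior γ y := by
    calc ∫⁻ θ, ((fun θ => ENNReal.ofReal (M.likelihood y θ ^ γ)) * g) θ ∂prior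
        ≤ ∫⁻ θ, (ENNReal.ofReal a * ENNReal.ofReal (M.likelihood y θ ^ γ)
          + ENNReal.ofReal (b * c)) ∂prior := by
          refine lintegral_mono fun θ => ?_
          rw [Pi.mul_apply, mul_comm]
          rcases h θ with h | h
          · exact le_add_right (mul_le_mul_left h _)
          · exact le_add_left h
      _ = ENNReal.ofReal a * M.evidence prior γ y + ENNReal.ofReal (b * c) := by
          rw [lintegral_add_right _ measurable_const, lintegral_const_mul _ hL, lintegral_const,
            measure_univ, mul_one, evidence]
      _ ≤ _ := by
          rw [ENNReal.ofReal_mul hb]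
          gcongr
  calc (M.evidence prior γ y)⁻¹ * _
      ≤ (M.evidence prior γ y)⁻¹ * ((ENNReal.ofReal a + ENNReal.ofReal b) * M.evidence prior γ y) := by
        rw [add_mul]
        exact mul_le_mul_right h1 _
    _ = ENNReal.ofReal a + ENNReal.ofReal b := by
        rw [mul_comm (_ + _), ← mul_assoc, ENNReal.inv_mul_cancel hev0 hev', one_mul]

end SubsetModel

/-! ### Second moments, `W2` and barycenters. -/

theorem W2_sq {Θ : Type u} [MetricSpace Θ] [MeasurableSpace Θ] (μ ν : Measure Θ) :
    W2 μ ν ^ 2 = ⨅ π ∈ couplings μ ν, ∫⁻ z, edist z.1 z.2 ^ 2 ∂π := by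
  rw [W2, ← ENNReal.rpow_natCast, ← ENNReal.rpow_mul]
  norm_num

section Wasserstein

variable {Θ : Type u} [MetricSpace Θ] [SecondCountableTopology Θ] [MeasurableSpace Θ] [BorelSpace Θ]

theorem W2_sq_dirac_right_le (μ : Measure Θ) [IsProbabilityMeasure μ] (θ₀ : Θ) :
    W2 μ (Measure.dirac θ₀) ^ 2 ≤ ∫⁻ θ, edist θ θ₀ ^ 2 ∂μ := by
  rw [W2_sq]
  have hm : Measurable fun θ : Θ => (θ, θ₀) := measurable_prodMk_right
  have hmem : μ.map (fun θ => (θ, θ₀)) ∈ couplings μ (Measure.dirac θ₀) := by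
    refine ⟨?_, ?_⟩
    · rw [Measure.map_map measurable_fst hm]
      exact Measure.map_id
    · rw [Measure.map_map measurable_snd hm]
      change μ.map (fun _ => θ₀) = _
      rw [Measure.map_const, measure_univ, one_smul]
  refine (iInf₂_le _ hmem).trans (le_of_eq ?_)
  rw [lintegral_map (measurable_edist.pow_const 2) hm]

theorem W2_sq_dirac_left_le (μ : Measure Θ) [IsProbabilityMeasure μ] (θ₀ : Θ) :
    W2 (Measure.dirac θ₀) μ ^ 2 ≤ ∫⁻ θ, edist θ θ₀ ^ 2 ∂μ := by
  rw [W2_sq]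
  have hm : Measurable fun θ : Θ => (θ₀, θ) := measurable_prodMk_left
  have hmem : μ.map (fun θ => (θ₀, θ)) ∈ couplings (Measure.dirac θ₀) μ := by
    refine ⟨?_, ?_⟩
    · rw [Measure.map_map measurable_fst hm]
      change μ.map (fun _ => θ₀) = _
      rw [Measure.map_const, measure_univ, one_smul]
    · rw [Measure.map_map measurable_snd hm]
      exact Measure.map_id
  refine (iInf₂_le _ hmem).trans (le_of_eq ?_)
  rw [lintegral_map (measurable_edist.pow_const 2) hm]
  simp only [edist_comm θ₀]

/-- Integrate `(s + t)² ≤ 2 s² + 2 t²` against an arbitrary coupling. This replaces the triangle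
inequality for `W2`, so couplings need not be glued. -/
theorem lintegral_edist_sq_le_W2_sq_add (μ ν : Measure Θ) (θ₀ : Θ) :
    ∫⁻ θ, edist θ θ₀ ^ 2 ∂μ ≤ 2 * W2 μ ν ^ 2 + 2 * ∫⁻ θ, edist θ θ₀ ^ 2 ∂ν := by
  have hg : Measurable fun θ : Θ => edist θ θ₀ ^ 2 :=
    (measurable_id.edist measurable_const).pow_const 2
  have hg2 : Measurable fun z : Θ × Θ => edist z.2 θ₀ ^ 2 := hg.comp measurable_snd
  rw [W2_sq, ENNReal.mul_iInf_of_ne two_ne_zero ENNReal.ofNat_ne_top, ENNReal.iInf_add]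
  refine le_iInf fun π => ?_
  rw [ENNReal.mul_iInf_of_ne two_ne_zero ENNReal.ofNat_ne_top, ENNReal.iInf_add]
  refine le_iInf fun hπ => ?_
  obtain ⟨h1, h2⟩ := hπ
  rw [← h1, ← h2, lintegral_map hg measurable_fst, lintegral_map hg measurable_snd,
    ← lintegral_const_mul _ hg2, ← lintegral_const_mul _ (measurable_edist.pow_const 2),
    ← lintegral_add_right _ (hg2.const_mul 2)]
  refine lintegral_mono fun z => ?_
  calc edist z.1 θ₀ ^ 2 ≤ (edist z.1 z.2 + edist z.2 θ₀) ^ 2 := by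
        gcongr
        exact edist_triangle _ _ _
    _ ≤ 2 * edist z.1 z.2 ^ 2 + 2 * edist z.2 θ₀ ^ 2 := by
        have h := ENNReal.rpow_add_le_mul_rpow_add_rpow (edist z.1 z.2) (edist z.2 θ₀)
          (one_le_two (α := ℝ))
        rw [show (2 : ℝ) - 1 = 1 by norm_num, ENNReal.rpow_one] at h
        simpa only [ENNReal.rpow_two, mul_add] using h

/-- A barycenter is close to `θ₀` if on average the averaged measures are. -/
theorem IsBarycenter.W2_sq_dirac_le {k : ℕ} (hk : 0 < k) {Pi : Fin k → Measure Θ}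
    (hPi : ∀ j, IsProbabilityMeasure (Pi j)) {μ : Measure Θ} (hμ : IsBarycenter Pi μ) (θ₀ : Θ) :
    W2 μ (Measure.dirac θ₀) ^ 2
      ≤ 4 * ∑ j, (k : ℝ≥0∞)⁻¹ * ∫⁻ θ, edist θ θ₀ ^ 2 ∂(Pi j) := by
  have hμp : IsProbabilityMeasure μ := hμ.1.1
  have hk0 : (k : ℝ≥0∞) ≠ 0 := by exact_mod_cast hk.ne'
  have hdirac : Measure.dirac θ₀ ∈ P2 Θ := by
    refine ⟨inferInstance, fun a => ?_⟩
    have hm : Measurable fun x : Θ => edist a x ^ 2 :=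
      (measurable_const.edist measurable_id).pow_const 2
    rw [lintegral_dirac' _ hm]
    exact ENNReal.pow_lt_top (edist_lt_top _ _)
  -- The Dirac mass is the competitor, and its cost is bounded by the average second moment.
  have h1 := hμ.2 _ hdirac
  have h2 : ∑ j, (k : ℝ≥0∞)⁻¹ * W2 (Measure.dirac θ₀) (Pi j) ^ 2
      ≤ ∑ j, (k : ℝ≥0∞)⁻¹ * ∫⁻ θ, edist θ θ₀ ^ 2 ∂(Pi j) :=
    Finset.sum_le_sum fun j _ => by
      gcongr
      exact W2_sq_dirac_left_le (Pi j) θ₀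
  calc W2 μ (Measure.dirac θ₀) ^ 2 ≤ ∫⁻ θ, edist θ θ₀ ^ 2 ∂μ := W2_sq_dirac_right_le μ θ₀
    _ = ∑ _j : Fin k, (k : ℝ≥0∞)⁻¹ * ∫⁻ θ, edist θ θ₀ ^ 2 ∂μ := by
        rw [Finset.sum_const, Finset.card_univ, Fintype.card_fin, nsmul_eq_mul, ← mul_assoc,
          ENNReal.mul_inv_cancel hk0 (ENNReal.natCast_ne_top k), one_mul]
    _ ≤ ∑ j, (k : ℝ≥0∞)⁻¹ * (2 * W2 μ (Pi j) ^ 2 + 2 * ∫⁻ θ, edist θ θ₀ ^ 2 ∂(Pi j)) :=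
        Finset.sum_le_sum fun j _ => by
          gcongr
          exact lintegral_edist_sq_le_W2_sq_add μ (Pi j) θ₀
    _ = 2 * ∑ j, (k : ℝ≥0∞)⁻¹ * W2 μ (Pi j) ^ 2
        + 2 * ∑ j, (k : ℝ≥0∞)⁻¹ * ∫⁻ θ, edist θ θ₀ ^ 2 ∂(Pi j) := by
        rw [Finset.mul_sum, Finset.mul_sum, ← Finset.sum_add_distrib]
        refine Finset.sum_congr rfl fun j _ => ?_
        ring
    _ ≤ 2 * (∑ j, (k : ℝ≥0∞)⁻¹ * ∫⁻ θ, edist θ θ₀ ^ 2 ∂(Pi j))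
        + 2 * ∑ j, (k : ℝ≥0∞)⁻¹ * ∫⁻ θ, edist θ θ₀ ^ 2 ∂(Pi j) := by
        exact add_le_add_left (mul_le_mul_right (h1.trans h2) 2) _
    _ = _ := by ring

end Wasserstein

/-! ### Posterior concentration in one subset. -/

namespace SubsetModel

variable {Θ : Type u} [MetricSpace Θ] [SecondCountableTopology Θ] [MeasurableSpace Θ] [BorelSpace Θ]
  {m : ℕ} {M : SubsetModel.{u, v} Θ m}

/-- Posterior concentration in one subset: off an exceptional set the posterior second moment is
at most the one over a Hellinger ball, up to an exponentially small remainder. -/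
theorem exists_posterior_exceptional_set (hm : 0 < m) (prior : Measure Θ)
    [IsProbabilityMeasure prior] (θ₀ : Θ) {r D₁ D₂ : ℝ} (hr : 0 < r)
    (hD : 0 < D₁) (hD1 : D₁ ≤ 1) (hD2 : D₂ < D₁ ^ 2 / 2 ^ 12) {Ψ : ℝ → ℝ → ℝ}
    (hΨ0 : ∀ u > 0, ∀ r > 0, 0 ≤ Ψ u r) (hΨ : ∀ r > 0, AntitoneOn (fun u => Ψ u r) (Set.Ioi 0))
    (hent : ∀ R ≥ r, (∀ u > 0,
        M.bracketingEntropy {θ | M.hell θ θ₀ ≤ R} u ≤ ((Ψ u R : ℝ) : EReal)) ∧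
      ∫ u in (D₁ * R ^ 2 / 2 ^ 12)..(D₁ * R), Real.sqrt (Ψ u R) < D₂ * Real.sqrt m * R ^ 2)
    {κ c π₀ T : ℝ} (hκ : 0 < κ) (hc : 0 ≤ c) (hπ₀ : 0 < π₀) (hT : 0 < T)
    (hprior : ENNReal.ofReal π₀
      ≤ prior {θ | M.expLogRatio κ θ₀ θ ≤ 1 + ENNReal.ofReal (c / m)})
    {γ Δ a b : ℝ} (hγ : 0 < γ) (hΔ : ∀ θ, dist θ θ₀ ≤ Δ)
    (ha : ∀ θ, M.hell θ θ₀ < r → dist θ θ₀ ^ 2 ≤ a) (hb0 : 0 ≤ b)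
    (hb : Δ ^ 2 * Real.exp (-(γ * (m * r ^ 2 / 32))) ≤ b * (π₀ / 2 * (((2 * T) ^ (1 / κ)) ^ γ)⁻¹)) :
    ∃ Bad : Set M.Data,
      M.law θ₀ Bad ≤ ENNReal.ofReal
        (2 ^ 11 / r * Real.exp (-(m * r ^ 2 / 2 ^ 20)) + Real.exp c / T) ∧
      ∀ y ∉ Bad, ∫⁻ θ, edist θ θ₀ ^ 2 ∂(M.posterior prior γ y)
        ≤ ENNReal.ofReal a + ENNReal.ofReal b := by
  obtain ⟨B₁, hB1, hB1'⟩ := exists_exceptional_set hm θ₀ hr hD hD1 hD2 hΨ0 hΨ hent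
  obtain ⟨B₂, hB2, hB2'⟩ := exists_evidence_exceptional_set hm prior θ₀ hκ hc hπ₀ hT hprior
  refine ⟨{y | ¬ ∀ i, 0 < M.p i θ₀ (y i)} ∪ (B₁ ∪ B₂), ?_, ?_⟩
  · refine (measure_union_le _ _).trans ?_
    have h0 : M.law θ₀ {y | ¬ ∀ i, 0 < M.p i θ₀ (y i)} = 0 := ae_law_p_pos θ₀
    rw [h0, zero_add, ENNReal.ofReal_add (by positivity) (by positivity)]
    exact (measure_union_le _ _).trans (add_le_add hB1 hB2)
  · intro y hy
    simp only [Set.mem_union, not_or, Set.mem_ofPred_eq, not_not] at hy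
    obtain ⟨hy0, hy1, hy2⟩ := hy
    have hL : 0 < M.likelihood y θ₀ := Finset.prod_pos fun i _ => hy0 i
    have hT' : 0 < (2 * T) ^ (1 / κ) := by positivity
    -- The radius `max r 2` exceeds the Hellinger diameter, so finitely many brackets bound the
    -- likelihood on all of `Θ`. Finiteness rules out the default value of the posterior.
    have hev : M.evidence prior γ y ≠ ∞ := by
      have hmax : 2 ≤ max r 2 := le_max_right _ _
      obtain ⟨B, hB⟩ := exists_likelihood_le hm (by nlinarith : 2 ≤ (max r 2) ^ 2)
        (by linarith) ((hent (max r 2) (le_max_left _ _)).1 1 one_pos) y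
      refine ne_top_of_le_ne_top (b := ENNReal.ofReal (B ^ γ)) ENNReal.ofReal_ne_top ?_
      refine (lintegral_mono fun θ => ENNReal.ofReal_le_ofReal
        (Real.rpow_le_rpow (likelihood_nonneg y θ) (hB θ) hγ.le)).trans ?_
      simp
    have hg : Measurable fun θ : Θ => edist θ θ₀ ^ 2 :=
      (measurable_id.edist measurable_const).pow_const 2
    refine lintegral_posterior_le hg hb0 (by positivity) (hB2' y hy2 γ hγ) hev fun θ => ?_
    have hed : ∀ x : ℝ, dist θ θ₀ ^ 2 ≤ x → edist θ θ₀ ^ 2 ≤ ENNReal.ofReal x := fun x hx => by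
      rw [edist_dist, ← ENNReal.ofReal_pow dist_nonneg]
      exact ENNReal.ofReal_le_ofReal hx
    rcases lt_or_ge (M.hell θ θ₀) r with h | h
    · exact Or.inl (hed a (ha θ h))
    · right
      have h1 := Real.rpow_le_rpow (likelihood_nonneg y θ) (hB1' y hy1 θ h) hγ.le
      rw [Real.mul_rpow (Real.exp_pos _).le hL.le, ← Real.exp_mul] at h1
      calc edist θ θ₀ ^ 2 * ENNReal.ofReal (M.likelihood y θ ^ γ)
          ≤ ENNReal.ofReal (Δ ^ 2) * ENNReal.ofReal
              (Real.exp (-(m * r ^ 2 / 32) * γ) * M.likelihood y θ₀ ^ γ) := by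
            gcongr
            exact hed _ (pow_le_pow_left₀ dist_nonneg (hΔ θ) 2)
        _ = ENNReal.ofReal (Δ ^ 2 * Real.exp (-(γ * (m * r ^ 2 / 32))) * M.likelihood y θ₀ ^ γ) := by
            rw [← ENNReal.ofReal_mul (sq_nonneg _), mul_assoc]
            congr 4
            ring
        _ ≤ _ := by
            apply ENNReal.ofReal_le_ofReal
            refine (mul_le_mul_of_nonneg_right hb (Real.rpow_nonneg hL.le γ)).trans (le_of_eq ?_)
            rw [Real.div_rpow hL.le hT'.le, div_eq_mul_inv (M.likelihood y θ₀ ^ γ)]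
            ring

end SubsetModel

/-! ### From single subsets to the full data. -/

section FullData

variable {Θ : Type u} [MetricSpace Θ] [SecondCountableTopology Θ] [MeasurableSpace Θ] [BorelSpace Θ]

/-- A tail bound for the barycenter from posterior moment bounds in the single subsets. -/
theorem fullLaw_W2_barycenter_le {k m : ℕ} (hk : 0 < k) (M : Fin k → SubsetModel.{u, v} Θ m)
    (prior : Measure Θ) [IsProbabilityMeasure prior] (γ : ℝ) (θ₀ : Θ) {Δ w q t : ℝ}
    (hΔ : ∀ θ, dist θ θ₀ ≤ Δ) (hw : 0 ≤ w) (hq : 0 ≤ q) (ht : 0 < t)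
    (hBad : ∀ j, ∃ Bad : Set (M j).Data, (M j).law θ₀ Bad ≤ ENNReal.ofReal q ∧
      ∀ y ∉ Bad, ∫⁻ θ, edist θ θ₀ ^ 2 ∂((M j).posterior prior γ y) ≤ ENNReal.ofReal w)
    (WASP : FullData M → Measure Θ) (hWASP : ∀ᵐ y ∂(fullLaw M θ₀),
      IsBarycenter (fun j => (M j).posterior prior γ (y j)) (WASP y)) :
    fullLaw M θ₀ {y | ENNReal.ofReal t < W2 (WASP y) (Measure.dirac θ₀)}
      ≤ ENNReal.ofReal (4 * (w + Δ ^ 2 * q) / t ^ 2) := by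
  choose Bad hB1 hB2 using hBad
  -- Exceptional sets may be nonmeasurable; the measurable hull has the same measure.
  set S : ∀ j, Set (M j).Data := fun j => toMeasurable ((M j).law θ₀) (Bad j) with hS
  have hSm : ∀ j, MeasurableSet (S j) := fun j => measurableSet_toMeasurable _ _
  have hk0 : (k : ℝ≥0∞) ≠ 0 := by exact_mod_cast hk.ne'
  -- A measurable majorant of the posterior moment, with the trivial bound `Δ²` on the exceptional
  -- set. Markov is applied to its average, so neither the posterior moments nor `WASP` need be
  -- measurable in the data.
  set g : ∀ j, (M j).Data → ℝ≥0∞ := fun j y =>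
    ENNReal.ofReal w + (S j).indicator (fun _ => ENNReal.ofReal (Δ ^ 2)) y with hg
  have hgm : ∀ j, Measurable (g j) := fun j =>
    Measurable.const_add (Measurable.indicator measurable_const (hSm j)) _
  have hle : ∀ j y, ∫⁻ θ, edist θ θ₀ ^ 2 ∂((M j).posterior prior γ y) ≤ g j y := by
    intro j y
    by_cases hy : y ∈ S j
    · have := SubsetModel.isProbabilityMeasure_posterior (M := M j) prior γ y
      refine le_trans ?_ (le_add_left (le_of_eq (Set.indicator_of_mem hy _).symm))
      have h1 : ∀ θ, edist θ θ₀ ^ 2 ≤ ENNReal.ofReal (Δ ^ 2) := fun θ => by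
        rw [edist_dist, ← ENNReal.ofReal_pow dist_nonneg]
        exact ENNReal.ofReal_le_ofReal (pow_le_pow_left₀ dist_nonneg (hΔ θ) 2)
      refine (lintegral_mono h1).trans (le_of_eq ?_)
      rw [lintegral_const, measure_univ, mul_one]
    · exact le_add_right (hB2 j y fun h => hy (subset_toMeasurable _ _ h))
  have hgint : ∀ j, ∫⁻ y, g j (y j) ∂(fullLaw M θ₀) ≤ ENNReal.ofReal (w + Δ ^ 2 * q) := by
    intro j
    have h1 : ∫⁻ y, g j (y j) ∂(fullLaw M θ₀) = ∫⁻ y, g j y ∂((M j).law θ₀) :=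
      (measurePreserving_eval (fun j => (M j).law θ₀) j).lintegral_comp (hgm j)
    rw [h1, lintegral_add_left measurable_const, lintegral_const, measure_univ, mul_one,
      lintegral_indicator_const (hSm j), measure_toMeasurable,
      ENNReal.ofReal_add hw (by positivity), ENNReal.ofReal_mul (sq_nonneg Δ)]
    gcongr
    exact hB1 j
  have hcomp : ∀ j, Measurable fun y : FullData M => g j (y j) := fun j =>
    (hgm j).comp (measurable_pi_apply j)
  have hGm : Measurable fun y : FullData M => 4 * ∑ j, (k : ℝ≥0∞)⁻¹ * g j (y j) :=
    (Finset.measurable_sum _ fun j _ => (hcomp j).const_mul _).const_mul 4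
  have hGint : ∫⁻ y, 4 * ∑ j, (k : ℝ≥0∞)⁻¹ * g j (y j) ∂(fullLaw M θ₀)
      ≤ ENNReal.ofReal (4 * (w + Δ ^ 2 * q)) := by
    rw [lintegral_const_mul _ (Finset.measurable_sum _ fun j _ => (hcomp j).const_mul _),
      lintegral_finsetSum _ fun j _ => (hcomp j).const_mul _,
      ENNReal.ofReal_mul (by norm_num : (0 : ℝ) ≤ 4), ENNReal.ofReal_ofNat]
    gcongr
    calc ∑ j, ∫⁻ y, (k : ℝ≥0∞)⁻¹ * g j (y j) ∂(fullLaw M θ₀)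
        ≤ ∑ _j : Fin k, (k : ℝ≥0∞)⁻¹ * ENNReal.ofReal (w + Δ ^ 2 * q) :=
          Finset.sum_le_sum fun j _ => by
            rw [lintegral_const_mul _ (hcomp j)]
            gcongr
            exact hgint j
      _ = _ := by
          rw [Finset.sum_const, Finset.card_univ, Fintype.card_fin, nsmul_eq_mul, ← mul_assoc,
            ENNReal.mul_inv_cancel hk0 (ENNReal.natCast_ne_top k), one_mul]
  have hmarkov := meas_ge_le_lintegral_div (μ := fullLaw M θ₀) hGm.aemeasurable
    (ε := ENNReal.ofReal (t ^ 2)) (by simpa using ht.ne') ENNReal.ofReal_ne_top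
  refine le_trans (measure_mono_ae ?_) (hmarkov.trans ((ENNReal.div_le_div_right hGint _).trans ?_))
  · filter_upwards [hWASP] with y hy hlt
    have h1 := hy.W2_sq_dirac_le hk
      (fun j => SubsetModel.isProbabilityMeasure_posterior (M := M j) prior γ (y j)) θ₀
    have h2 : ENNReal.ofReal (t ^ 2) ≤ W2 (WASP y) (Measure.dirac θ₀) ^ 2 := by
      rw [ENNReal.ofReal_pow ht.le]
      have h3 : ENNReal.ofReal t < W2 (WASP y) (Measure.dirac θ₀) := hlt
      gcongr
    refine (h2.trans h1).trans ?_
    gcongr with j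
    exact hle j (y j)
  · rw [ENNReal.ofReal_div_of_pos (by positivity)]

end FullData

/-! ### Numerical comparisons. -/

/-- The exponent comparison behind posterior concentration: the likelihood ratio away from `θ₀`
beats the evidence. -/
theorem exp_neg_le_evidence_factor {γ ℓ κ c g n A : ℝ} (hγ : 0 < γ) (hℓ : 1 ≤ ℓ) (hκ : 0 < κ)
    (hc : 0 < c) (hn : 1 ≤ n) (hng : n ≤ g * γ) (hA : 32 * (2 * g + c * g + 3 / κ) ≤ A ^ 2) :
    Real.exp (-(γ * (A ^ 2 * ℓ / 32)))
      ≤ Real.exp (-ℓ) *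
        (Real.exp (-c * n * ℓ) / 2 * (((2 * Real.exp (2 * ℓ)) ^ (1 / κ)) ^ γ)⁻¹) := by
  have h2 : (2 : ℝ) ≤ Real.exp ℓ := by
    have := Real.add_one_le_exp ℓ
    linarith
  have h3 : ((2 * Real.exp (2 * ℓ)) ^ (1 / κ)) ^ γ ≤ Real.exp (3 * ℓ / κ * γ) := by
    have h4 : 2 * Real.exp (2 * ℓ) ≤ Real.exp (3 * ℓ) := by
      rw [show 3 * ℓ = ℓ + 2 * ℓ by ring, Real.exp_add]
      exact mul_le_mul_of_nonneg_right h2 (Real.exp_pos _).le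
    have h5 := Real.rpow_le_rpow (by positivity) h4 (one_div_nonneg.2 hκ.le)
    rw [← Real.exp_mul] at h5
    have h6 := Real.rpow_le_rpow (by positivity) h5 hγ.le
    rw [← Real.exp_mul] at h6
    refine h6.trans (le_of_eq ?_)
    congr 1
    ring
  have h7 : Real.exp (-(3 * ℓ / κ * γ)) ≤ (((2 * Real.exp (2 * ℓ)) ^ (1 / κ)) ^ γ)⁻¹ := by
    rw [Real.exp_neg]
    exact inv_anti₀ (by positivity) h3
  have h8 : Real.exp (-c * n * ℓ - ℓ) ≤ Real.exp (-c * n * ℓ) / 2 := by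
    rw [Real.exp_sub]
    exact div_le_div_of_nonneg_left (Real.exp_pos _).le two_pos h2
  calc Real.exp (-(γ * (A ^ 2 * ℓ / 32)))
      ≤ Real.exp (-ℓ + ((-c * n * ℓ - ℓ) + -(3 * ℓ / κ * γ))) := by
        apply Real.exp_le_exp.2
        have hℓ0 : 0 ≤ ℓ := by linarith
        -- Three costs are paid: `2 ℓ` for the remainder and the factor `1/2`, `c n ℓ` for the prior
        -- mass, `3 ℓ γ / κ` for the likelihood comparison. Since `1 ≤ n ≤ g γ`, all are multiples
        -- of `γ ℓ`.
        have e1 := mul_le_mul_of_nonneg_left hA (mul_nonneg hγ.le hℓ0)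
        have e2 : ℓ ≤ g * γ * ℓ := by nlinarith
        have e3 : c * n * ℓ ≤ c * (g * γ) * ℓ :=
          mul_le_mul_of_nonneg_right (mul_le_mul_of_nonneg_left hng hc.le) hℓ0
        have e4 : γ * ℓ * (32 * (2 * g + c * g + 3 / κ))
            = 32 * (2 * (g * γ * ℓ) + c * (g * γ) * ℓ + 3 * ℓ / κ * γ) := by ring
        linarith
    _ ≤ _ := by
        rw [Real.exp_add, Real.exp_add]
        gcongr

/-- The exceptional probability of one subset at the radius `A * log m / √m`. -/
theorem exceptional_probability_le {A m r : ℝ} (hA : 2 ^ 11 ≤ A) (hm : 1 ≤ m)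
    (hl : 1 ≤ Real.log m) (hr : r = A * Real.log m / Real.sqrt m) :
    2 ^ 11 / r * Real.exp (-(m * r ^ 2 / 2 ^ 20))
        + Real.exp (Real.log m ^ 2) / Real.exp (2 * Real.log m ^ 2)
      ≤ 2 * Real.exp (-Real.log m ^ 2) := by
  have hm' : 0 < m := by linarith
  have hl0 : 0 < Real.log m := by linarith
  have hsm : 0 < Real.sqrt m := Real.sqrt_pos.2 hm'
  have hA0 : 0 < A := by linarith
  have hr0 : 0 < r := by rw [hr]; positivity
  have hmr : m * r ^ 2 = A ^ 2 * Real.log m ^ 2 := by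
    rw [hr, div_pow, Real.sq_sqrt hm'.le, mul_pow]
    field_simp
  have hlog : Real.log m ≤ Real.log m ^ 2 := by nlinarith
  have h1 : Real.exp (Real.log m ^ 2) / Real.exp (2 * Real.log m ^ 2)
      = Real.exp (-Real.log m ^ 2) := by
    rw [← Real.exp_sub]
    congr 1
    ring
  have h2 : 2 ^ 11 / r ≤ Real.exp (Real.log m ^ 2) := by
    have h3 : 2 ^ 11 / r ≤ Real.sqrt m := by
      rw [div_le_iff₀ hr0, hr, mul_div_cancel₀ _ hsm.ne']
      exact hA.trans (le_mul_of_one_le_right hA0.le hl)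
    refine h3.trans (((Real.sqrt_le_left hm'.le).2 (by nlinarith)).trans ?_)
    calc m = Real.exp (Real.log m) := (Real.exp_log hm').symm
      _ ≤ _ := Real.exp_le_exp.2 hlog
  -- `A ≥ 2^11` gives an exponent of at least `4 log² m`. Half of that suffices, since the prefactor
  -- costs at most `log² m`.
  have h6 : Real.exp (-(m * r ^ 2 / 2 ^ 20)) ≤ Real.exp (-(2 * Real.log m ^ 2)) := by
    apply Real.exp_le_exp.2
    rw [hmr]
    have h7 : (2 ^ 11) ^ 2 * Real.log m ^ 2 ≤ A ^ 2 * Real.log m ^ 2 :=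
      mul_le_mul_of_nonneg_right (pow_le_pow_left₀ (by norm_num) hA 2) (sq_nonneg _)
    have h8 := sq_nonneg (Real.log m)
    linarith
  have h9 := mul_le_mul h2 h6 (Real.exp_pos _).le (Real.exp_pos _).le
  rw [← Real.exp_add, show Real.log m ^ 2 + -(2 * Real.log m ^ 2) = -Real.log m ^ 2 by ring] at h9
  rw [h1]
  linarith

end

/-! ### Choice of constants and conclusion. -/

/-- The parameter space `Θ ⊆ ℝ^d`, with inclusion `coord`, is compact in its own metric `ρ`, and
carries the Borel σ-algebra of `ρ`. There are `k m` subsets of size `m`, and `WASP m y` is any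
barycenter of the subset posteriors. -/
theorem theorem3p2 {Θ : Type*} [MetricSpace Θ] [CompactSpace Θ] [MeasurableSpace Θ] [BorelSpace Θ]
    {d : ℕ} (coord : Θ → EuclideanSpace ℝ (Fin d))
    (coord_injective : Function.Injective coord) (coord_measurable : Measurable coord)
    (θ₀ : Θ) (hθ₀ : coord θ₀ ∈ interior (Set.range coord))
    (prior : Measure Θ) [IsProbabilityMeasure prior] (prior_ac : prior.map coord ≪ volume)
    (k : ℕ → ℕ) (γ : ℕ → ℝ) (M : ∀ m, Fin (k m) → SubsetModel Θ m) (α : ℝ) (hα : 0 < α)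
    (A1 : PowerCondition k γ) (A2 : HellingerLowerBound M α) (A3 : EntropyCondition M θ₀)
    (A4 : PriorThickness M prior θ₀) (A5 : ConvexMetric coord)
    (WASP : ∀ m, FullData (M m) → Measure Θ)
    (hWASP : ∀ᶠ m in atTop, ∀ᵐ y ∂(fullLaw (M m) θ₀),
      IsBarycenter (fun j => (M m j).posterior prior (γ m) (y j)) (WASP m y)) :
    IsBigOInProbability (fun m => fullLaw (M m) θ₀)
      (fun m y => W2 (WASP m y) (Measure.dirac θ₀))
      (fun m => Real.sqrt (Real.log m ^ (2 / α) / (m : ℝ) ^ (1 / α))) := by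
  obtain ⟨hγ, g₁, hg₁, g₂, hg₂, hA1⟩ := A1
  obtain ⟨C, hC, hA2⟩ := A2
  obtain ⟨D₁, D₂, K, Ψ, hD, hD1, -, hD2, hK, hΨ0, hΨ, -, hA3⟩ := A3
  obtain ⟨κ, hκ, c, hc, hA4⟩ := A4
  set Δ : ℝ := Metric.diam (Set.univ : Set Θ) with hΔdef
  have hΔ : ∀ θ, dist θ θ₀ ≤ Δ := fun θ =>
    Metric.dist_le_diam_of_mem isCompact_univ.isBounded (Set.mem_univ _) (Set.mem_univ _)
  set Q : ℝ := 2 * g₂ + c * g₂ + 3 / κ with hQ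
  have hQ0 : 0 ≤ Q := by positivity
  -- Large enough for three purposes: the range of radii in (A3), the exceptional probability, and
  -- `32 Q ≤ A²` in the comparison with the evidence.
  set A : ℝ := K + 2 ^ 11 + 32 * Q with hA
  have hAK : K ≤ A := by linarith
  have hA11 : 2 ^ 11 ≤ A := by linarith
  have hAQ : 32 * Q ≤ A ^ 2 := by
    have : 32 * Q ≤ A := by linarith
    nlinarith
  -- The contributions of the Hellinger ball, of the posterior remainder, and of the exceptional
  -- sets, which have probability at most `2 exp(-ℓ)`.
  set V : ℝ := (A ^ 2 / C) ^ (1 / α) + Δ ^ 2 + Δ ^ 2 * 2 with hV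
  have hV0 : 0 ≤ V := by positivity
  intro ε hε
  have ht0 : 0 < Real.sqrt (4 * V / ε) + 1 := by positivity
  refine ⟨Real.sqrt (4 * V / ε) + 1, ht0, ?_⟩
  have hlog : Tendsto (fun m : ℕ => Real.log m) atTop atTop :=
    Real.tendsto_log_atTop.comp tendsto_natCast_atTop_atTop
  filter_upwards [hA1, hA2, hA3, hA4, hWASP, hlog.eventually_ge_atTop (max 1 (1 / α)),
    eventually_gt_atTop 0] with m hA1 hA2 hA3 hA4 hWASP hlogm hm
  have hm' : (0 : ℝ) < m := by exact_mod_cast hm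
  have hl1 : 1 ≤ Real.log m := (le_max_left _ _).trans hlogm
  have hlα : 1 / α ≤ Real.log m := (le_max_right _ _).trans hlogm
  have hl0 : 0 < Real.log m := by linarith
  set ℓ : ℝ := Real.log m ^ 2 with hℓ
  have hℓ1 : 1 ≤ ℓ := one_le_pow₀ hl1
  have hℓl : Real.log m ≤ ℓ := by rw [hℓ]; nlinarith
  set s : ℝ := (ℓ / m) ^ (1 / α) with hs
  have hs0 : 0 < s := by positivity
  have hrate : Real.log m ^ (2 / α) / (m : ℝ) ^ (1 / α) = s := by
    rw [hs, Real.div_rpow (by positivity) hm'.le, hℓ, ← Real.rpow_natCast, ← Real.rpow_mul hl0.le]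
    congr 2
    push_cast
    ring
  -- Because `log m ≥ 1/α`, `exp(-log² m)` is at most `m^(-1/α)`.
  have hexps : Real.exp (-ℓ) ≤ s := by
    have h1 : (1 / (m : ℝ)) ^ (1 / α) ≤ s :=
      Real.rpow_le_rpow (by positivity) (div_le_div_of_nonneg_right hℓ1 hm'.le) (by positivity)
    refine le_trans ?_ h1
    rw [Real.rpow_def_of_pos (by positivity), one_div (m : ℝ), Real.log_inv]
    apply Real.exp_le_exp.2
    have : Real.log m * (1 / α) ≤ Real.log m * Real.log m :=
      mul_le_mul_of_nonneg_left hlα hl0.le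
    rw [hℓ]
    linarith
  have hγm := hγ m
  have hk : 0 < k m := by
    have h1 : 0 < g₁ * γ m * m := by positivity
    have h2 : (0 : ℝ) < (k m : ℝ) * m := h1.trans_le hA1.1
    exact_mod_cast pos_of_mul_pos_left h2 hm'.le
  have hk1 : (1 : ℝ) ≤ k m := by exact_mod_cast hk
  have hkg : (k m : ℝ) ≤ g₂ * γ m := le_of_mul_le_mul_right hA1.2 hm'
  set r : ℝ := A * Real.log m / Real.sqrt m with hr
  have hr0 : 0 < r := by positivity
  have hmr : m * r ^ 2 = A ^ 2 * ℓ := by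
    rw [hr, div_pow, Real.sq_sqrt hm'.le, mul_pow, mul_div_cancel₀ _ hm'.ne']
  have hrm : r ^ 2 = A ^ 2 * (ℓ / m) := by
    rw [← mul_div_assoc, ← hmr]
    field_simp
  have hq : 2 ^ 11 / r * Real.exp (-(m * r ^ 2 / 2 ^ 20)) + Real.exp ℓ / Real.exp (2 * ℓ)
      ≤ 2 * Real.exp (-ℓ) :=
    exceptional_probability_le hA11 (by exact_mod_cast hm) hl1 hr
  have hbad : ∀ j, ∃ Bad : Set (M m j).Data,
      (M m j).law θ₀ Bad ≤ ENNReal.ofReal (2 * Real.exp (-ℓ)) ∧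
      ∀ y ∉ Bad, ∫⁻ θ, edist θ θ₀ ^ 2 ∂((M m j).posterior prior (γ m) y)
        ≤ ENNReal.ofReal ((A ^ 2 / C) ^ (1 / α) * s + Δ ^ 2 * Real.exp (-ℓ)) := by
    intro j
    obtain ⟨Bad, h1, h2⟩ := SubsetModel.exists_posterior_exceptional_set (M := M m j) hm prior θ₀ hr0
      hD hD1 hD2 hΨ0 hΨ (fun R hR => by
        have h3 := hA3 R (hr0.trans_le hR) (le_trans (by
          rw [hr]
          gcongr) hR)
        exact ⟨fun u hu => h3.1 j u hu, h3.2⟩)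
      -- With `T = exp(2 ℓ)` the evidence bound fails with probability at most `exp(ℓ) / T =
      -- exp(-ℓ)`.
      hκ (by linarith : 0 ≤ ℓ) (Real.exp_pos _) (Real.exp_pos (2 * ℓ)) (hA4 j) hγm hΔ
      (a := (A ^ 2 / C) ^ (1 / α) * s) (b := Δ ^ 2 * Real.exp (-ℓ))
      (fun θ hθ => by
        have h3 := hA2 j θ θ₀
        have h4 : (M m j).hell θ θ₀ ^ 2 ≤ r ^ 2 :=
          pow_le_pow_left₀ (Real.sqrt_nonneg _) hθ.le 2
        have h5 : dist θ θ₀ ^ (2 * α) ≤ A ^ 2 / C * (ℓ / m) := by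
          rw [div_mul_eq_mul_div, le_div_iff₀ hC, ← hrm]
          linarith
        have h6 := Real.rpow_le_rpow (Real.rpow_nonneg dist_nonneg _) h5
          (one_div_nonneg.2 hα.le)
        rw [← Real.rpow_mul dist_nonneg, Real.mul_rpow (by positivity) (by positivity),
          show 2 * α * (1 / α) = (2 : ℕ) by field_simp; norm_num, Real.rpow_natCast] at h6
        exact h6)
      (by positivity)
      (by
        rw [hmr, mul_assoc]
        exact mul_le_mul_of_nonneg_left
          (exp_neg_le_evidence_factor hγm hℓ1 hκ hc hk1 hkg hAQ) (sq_nonneg _))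
    refine ⟨Bad, h1.trans (ENNReal.ofReal_le_ofReal hq), fun y hy => (h2 y hy).trans ?_⟩
    rw [ENNReal.ofReal_add (by positivity) (by positivity)]
  refine (fullLaw_W2_barycenter_le hk (M m) prior (γ m) θ₀ hΔ (by positivity) (by positivity)
    (mul_pos ht0 (Real.sqrt_pos.2 (hrate ▸ hs0))) hbad (WASP m) hWASP).trans ?_
  apply ENNReal.ofReal_le_ofReal
  rw [hrate, mul_pow, Real.sq_sqrt hs0.le, div_le_iff₀ (by positivity)]
  have h1 : 4 * V ≤ ε * (Real.sqrt (4 * V / ε) + 1) ^ 2 := by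
    have h2 : 4 * V / ε ≤ (Real.sqrt (4 * V / ε) + 1) ^ 2 := by
      have h3 := Real.sq_sqrt (show 0 ≤ 4 * V / ε by positivity)
      have h4 := Real.sqrt_nonneg (4 * V / ε)
      linarith [add_sq (Real.sqrt (4 * V / ε)) 1]
    rwa [div_le_iff₀' hε] at h2
  calc 4 * ((A ^ 2 / C) ^ (1 / α) * s + Δ ^ 2 * Real.exp (-ℓ) + Δ ^ 2 * (2 * Real.exp (-ℓ)))
      ≤ 4 * ((A ^ 2 / C) ^ (1 / α) * s + Δ ^ 2 * s + Δ ^ 2 * (2 * s)) := by gcongr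
    _ = 4 * V * s := by rw [hV]; ring
    _ ≤ ε * (Real.sqrt (4 * V / ε) + 1) ^ 2 * s := mul_le_mul_of_nonneg_right h1 hs0.le
    _ = _ := by ring
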